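/- Let $n\ge 2$, let $C^*(F_{n-1})$ be the full group C$^*$-algebra of the free group on $n-1$ generators, and let $u_1,\dots,u_{n-1}\in C^*(F_{n-1})$ be universal unitaries that generate it (i.e. unitaries generating $C^*(F_{n-1})$ such that for all unitaries $v_1,\dots,v_{n-1}$ in a unital C$^*$-algebra $B$ there is a unital $*$-homomorphism $C^*(F_{n-1})\to B$ with $u_j\mapsto v_j$). Let $S_{n-1}=\mathrm{Span}\{1,u_j,u_j^*:1\le j\le n-1\}\subseteq C^*(F_{n-1})$, let $T_n\subseteq M_n(\mathbb C)$ be the operator system of tridiagonal matrices ($A_{ij}=0$ for $|i-j|\ge 2$), and let $J_n\subseteq T_n$ be the space of diagonal matrices of trace $0$. Let $\phi:T_n\to S_{n-1}$ be the linear map with $$\phi(E_{ii})=\tfrac1n 1\ (1\le i\le n),\qquad \phi(E_{i,i+1})=\tfrac1n u_i,\quad \phi(E_{i+1,i})=\tfrac1n u_i^*\ (1\le i\le n-1).$$ For an operator system $S$ with unit $1$ and a kernel $J\subseteq S$ (i.e. the kernel of a completely positive map from $S$ into some operator system), let $q:S\to S/J$ be the canonical map, applied entrywise to matrices, and for $p\in\mathbb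 N$ let $$D_p(S/J)=\{q(H): H\in M_p(S)_{\rm sa},\ \exists K\in M_p(J)_{\rm sa},\ H+K\in M_p(S)_+\},$$ $$C_p(S/J)=\{q(H): H\in M_p(S)_{\rm sa},\ \forall\varepsilon>0\ \exists K_\varepsilon\in M_p(J)_{\rm sa},\ \varepsilon 1+H+K_\varepsilon\in M_p(S)_+\}.$$ The quotient operator system is $S/J$ with the positive cones $C_p(S/J)$ and order unit $q(1)$. The kernel $J$ is completely order proximinal if $D_p(S/J)=C_p(S/J)$ for all $p$. A completely positive linear map $\psi:S\to T$ is a complete quotient map if the induced linear map $\dot\psi:S/\ker\psi\to T$ is a complete order isomorphism, that is, a linear bijection that is completely positive together with its inverse. Then: 1. $\ker\phi=J_n$; 2. $J_n\subseteq T_n$ is a completely order proximinal kernel; 3. $\phi$ is a complete quotient map. In particular $T_n/J_n\cong S_{n-1}$ through a complete order isomorphism sending $q(X)$ to $\phi(X)$ for all $X\in T_n$. -/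

import Mathlib

noncomputable section
open scoped ComplexConjugate

universe u v

namespace OpSys

/-- The adjoint `[x_{ij}]^* = [x_{ji}^*]` of a matrix over a space with involution. -/
def matAdj {V : Type*} [AddCommGroup V] [Module ℂ V] (s : V →ₗ⋆[ℂ] V) {p : ℕ}
    (X : Matrix (Fin p) (Fin p) V) : Matrix (Fin p) (Fin p) V :=
  Matrix.of fun i j => s (X j i)

/-- The matrix `a^* X a`, for a scalar matrix `a` and a matrix `X` over `V`. -/
def compress {V : Type*} [AddCommGroup V] [Module ℂ V] {p q : ℕ}
    (a : Matrix (Fin p) (Fin q) ℂ) (X : Matrix (Fin p) (Fin p) V) : Matrix (Fin q) (Fin q) V :=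
  Matrix.of fun k l => ∑ i, ∑ j, (conj (a i k) * a j l) • X i j

/-- The matrix `e ⊗ 1_p`. -/
def diagUnit {V : Type*} [AddCommGroup V] (e : V) (p : ℕ) : Matrix (Fin p) (Fin p) V :=
  Matrix.diagonal fun _ => e

end OpSys

open OpSys

/-- An (abstract) operator system structure on a complex vector space `V`: an involution, a
matrix ordering by proper cones of selfadjoint matrices, and an Archimedean matrix order unit. -/
structure OperatorSystem (V : Type u) [AddCommGroup V] [Module ℂ V] where
  /-- the involution -/
  adj : V →ₗ⋆[ℂ] V
  adj_adj : ∀ x, adj (adj x) = x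
  /-- the order unit -/
  unit : V
  adj_unit : adj unit = unit
  /-- the positive cone of `M_p(V)` -/
  cone : (p : ℕ) → Set (Matrix (Fin p) (Fin p) V)
  cone_adj : ∀ {p : ℕ} {X : Matrix (Fin p) (Fin p) V}, X ∈ cone p → matAdj adj X = X
  cone_add : ∀ {p : ℕ} {X Y : Matrix (Fin p) (Fin p) V},
    X ∈ cone p → Y ∈ cone p → X + Y ∈ cone p
  cone_compress : ∀ {p q : ℕ} (a : Matrix (Fin p) (Fin q) ℂ) {X : Matrix (Fin p) (Fin p) V},
    X ∈ cone p → compress a X ∈ cone q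
  cone_proper : ∀ {p : ℕ} {X : Matrix (Fin p) (Fin p) V}, X ∈ cone p → -X ∈ cone p → X = 0
  order_unit : ∀ {p : ℕ} (X : Matrix (Fin p) (Fin p) V), matAdj adj X = X →
    ∃ r : ℝ, 0 < r ∧ (r : ℂ) • diagUnit unit p + X ∈ cone p
  archimedean : ∀ {p : ℕ} (X : Matrix (Fin p) (Fin p) V),
    (∀ ε : ℝ, 0 < ε → (ε : ℂ) • diagUnit unit p + X ∈ cone p) → X ∈ cone p

namespace OperatorSystem

variable {V : Type u} [AddCommGroup V] [Module ℂ V] {W : Type v} [AddCommGroup W] [Module ℂ W]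

/-- `φ` is completely positive: every `φ^{(p)}` maps positive matrices to positive matrices. -/
def IsCP (𝒮 : OperatorSystem V) (𝒯 : OperatorSystem W) (φ : V →ₗ[ℂ] W) : Prop :=
  ∀ (p : ℕ), ∀ X ∈ 𝒮.cone p, X.map φ ∈ 𝒯.cone p

/-- `φ` is a complete order isomorphism: a linear isomorphism such that `φ` and `φ⁻¹` are
completely positive. -/
def IsCompleteOrderIso (𝒮 : OperatorSystem V) (𝒯 : OperatorSystem W) (φ : V →ₗ[ℂ] W) : Prop :=
  ∃ e : V ≃ₗ[ℂ] W, e.toLinearMap = φ ∧ 𝒮.IsCP 𝒯 e.toLinearMap ∧ 𝒯.IsCP 𝒮 e.symm.toLinearMap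

/-- A subspace is a kernel if it is the kernel of a completely positive map into some operator
system (in the universe of `V`, which also contains the quotient `V ⧸ J`). -/
def IsKernel (𝒮 : OperatorSystem V) (J : Submodule ℂ V) : Prop :=
  ∃ (W : Type u) (_ : AddCommGroup W) (_ : Module ℂ W) (𝒯 : OperatorSystem W) (φ : V →ₗ[ℂ] W),
    𝒮.IsCP 𝒯 φ ∧ J = LinearMap.ker φ

/-- `D_p(S/J)`: the classes of those selfadjoint `H ∈ M_p(S)` for which `H + K` is positive for
some selfadjoint `K ∈ M_p(J)`. -/
def D (𝒮 : OperatorSystem V) (J : Submodule ℂ V) (p : ℕ) : Set (Matrix (Fin p) (Fin p) (V ⧸ J)) :=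
  {x | ∃ H : Matrix (Fin p) (Fin p) V, matAdj 𝒮.adj H = H ∧ H.map J.mkQ = x ∧
    ∃ K : Matrix (Fin p) (Fin p) V, matAdj 𝒮.adj K = K ∧ (∀ i j, K i j ∈ J) ∧ H + K ∈ 𝒮.cone p}

/-- `C_p(S/J)`: the classes of those selfadjoint `H ∈ M_p(S)` such that, for every `ε > 0`,
`ε 1 + H + K` is positive for some selfadjoint `K ∈ M_p(J)`. -/
def C (𝒮 : OperatorSystem V) (J : Submodule ℂ V) (p : ℕ) : Set (Matrix (Fin p) (Fin p) (V ⧸ J)) :=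
  {x | ∃ H : Matrix (Fin p) (Fin p) V, matAdj 𝒮.adj H = H ∧ H.map J.mkQ = x ∧
    ∀ ε : ℝ, 0 < ε →
      ∃ K : Matrix (Fin p) (Fin p) V, matAdj 𝒮.adj K = K ∧ (∀ i j, K i j ∈ J) ∧
        (ε : ℂ) • diagUnit 𝒮.unit p + H + K ∈ 𝒮.cone p}

/-- A kernel `J` is completely order proximinal if `D_p(S/J) = C_p(S/J)` for every `p`. -/
def IsCompletelyOrderProximinal (𝒮 : OperatorSystem V) (J : Submodule ℂ V) : Prop :=
  𝒮.IsKernel J ∧ ∀ p : ℕ, 𝒮.D J p = 𝒮.C J p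

lemma matAdj_add (s : V →ₗ⋆[ℂ] V) {p : ℕ} (X Y : Matrix (Fin p) (Fin p) V) :
    matAdj s (X + Y) = matAdj s X + matAdj s Y := by
  ext i j; simp [matAdj]

lemma matAdj_sub (s : V →ₗ⋆[ℂ] V) {p : ℕ} (X Y : Matrix (Fin p) (Fin p) V) :
    matAdj s (X - Y) = matAdj s X - matAdj s Y := by
  ext i j; simp [matAdj]

lemma matAdj_smul (s : V →ₗ⋆[ℂ] V) {p : ℕ} (r : ℝ) (X : Matrix (Fin p) (Fin p) V) :
    matAdj s ((r : ℂ) • X) = (r : ℂ) • matAdj s X := by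
  ext i j
  simp only [matAdj, Matrix.of_apply, Matrix.smul_apply, map_smulₛₗ, Complex.conj_ofReal]

lemma matAdj_diagUnit (𝒮 : OperatorSystem V) (p : ℕ) :
    matAdj 𝒮.adj (diagUnit 𝒮.unit p) = diagUnit 𝒮.unit p := by
  ext i j
  by_cases h : i = j
  · subst h; simp [matAdj, diagUnit, 𝒮.adj_unit]
  · simp [matAdj, diagUnit, Matrix.diagonal_apply_ne _ h, Matrix.diagonal_apply_ne' _ h]

lemma matAdj_matAdj (𝒮 : OperatorSystem V) {p : ℕ} (X : Matrix (Fin p) (Fin p) V) :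
    matAdj 𝒮.adj (matAdj 𝒮.adj X) = X := by
  ext i j; simp [matAdj, 𝒮.adj_adj]

lemma compress_add {p q : ℕ} (a : Matrix (Fin p) (Fin q) ℂ) (X Y : Matrix (Fin p) (Fin p) V) :
    compress a (X + Y) = compress a X + compress a Y := by
  ext i j; simp [compress, Finset.sum_add_distrib]

lemma compress_smul {p q : ℕ} (a : Matrix (Fin p) (Fin q) ℂ) (c : ℂ)
    (X : Matrix (Fin p) (Fin p) V) : compress a (c • X) = c • compress a X := by
  ext i j
  simp only [compress, Matrix.of_apply, Matrix.smul_apply, Finset.smul_sum]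
  refine Finset.sum_congr rfl fun k _ => Finset.sum_congr rfl fun l _ => ?_
  rw [smul_comm]

lemma compress_map {p q : ℕ} (a : Matrix (Fin p) (Fin q) ℂ) (X : Matrix (Fin p) (Fin p) V)
    (φ : V →ₗ[ℂ] W) : (compress a X).map φ = compress a (X.map φ) := by
  ext i j; simp [compress]

lemma matAdj_compress (s : V →ₗ⋆[ℂ] V) {p q : ℕ} (a : Matrix (Fin p) (Fin q) ℂ)
    (X : Matrix (Fin p) (Fin p) V) : matAdj s (compress a X) = compress a (matAdj s X) := by
  ext i j
  simp only [matAdj, compress, Matrix.of_apply, map_sum]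
  rw [Finset.sum_comm]
  refine Finset.sum_congr rfl fun k _ => Finset.sum_congr rfl fun l _ => ?_
  simp [mul_comm]

lemma cone_smul (𝒮 : OperatorSystem V) {p : ℕ} {X : Matrix (Fin p) (Fin p) V} (t : ℝ)
    (ht : 0 ≤ t) (hX : X ∈ 𝒮.cone p) : (t : ℂ) • X ∈ 𝒮.cone p := by
  have h := 𝒮.cone_compress (Matrix.diagonal fun _ => ((Real.sqrt t : ℝ) : ℂ)) hX
  convert h using 1
  ext i j
  simp only [compress, Matrix.of_apply, Matrix.smul_apply]
  rw [Finset.sum_eq_single i, Finset.sum_eq_single j]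
  · simp [← Complex.ofReal_mul, Real.mul_self_sqrt ht]
  · intro b _ hb; simp [Matrix.diagonal_apply_ne _ hb]
  · simp
  · intro b _ hb; simp [Matrix.diagonal_apply_ne _ hb]
  · simp

lemma unit_mem (𝒮 : OperatorSystem V) (p : ℕ) : diagUnit 𝒮.unit p ∈ 𝒮.cone p := by
  obtain ⟨r, hr, h⟩ := 𝒮.order_unit (p := p) 0 (by ext i j; simp [matAdj])
  have := 𝒮.cone_smul r⁻¹ (by positivity) h
  rwa [add_zero, smul_smul, ← Complex.ofReal_mul, inv_mul_cancel₀ hr.ne', Complex.ofReal_one,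
    one_smul] at this

lemma map_smul_add (φ : V →ₗ[ℂ] W) {p : ℕ} (c : ℂ) (X Y : Matrix (Fin p) (Fin p) V) :
    (c • X + Y).map φ = c • X.map φ + Y.map φ := by
  ext i j; simp

lemma diagUnit_map (φ : V →ₗ[ℂ] W) (e : V) (p : ℕ) :
    (diagUnit e p).map φ = diagUnit (φ e) p := by
  simp [diagUnit, Matrix.diagonal_map]

lemma C_mem_iff (𝒮 : OperatorSystem V) (J : Submodule ℂ V) {p : ℕ}
    (x : Matrix (Fin p) (Fin p) (V ⧸ J)) :
    x ∈ 𝒮.C J p ↔ ∀ ε : ℝ, 0 < ε → ∃ Y ∈ 𝒮.cone p,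
      Y.map J.mkQ = (ε : ℂ) • diagUnit (J.mkQ 𝒮.unit) p + x := by
  constructor
  · rintro ⟨H, -, rfl, h⟩ ε hε
    obtain ⟨K, -, hK, hp⟩ := h ε hε
    refine ⟨_, hp, ?_⟩
    rw [add_assoc, map_smul_add, diagUnit_map]
    congr 1
    ext i j
    simp [(Submodule.Quotient.mk_eq_zero J).2 (hK i j)]
  · intro h
    obtain ⟨Y₁, hY₁, hx₁⟩ := h 1 one_pos
    have hs : matAdj 𝒮.adj (Y₁ - diagUnit 𝒮.unit p) = Y₁ - diagUnit 𝒮.unit p := by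
      rw [matAdj_sub, matAdj_diagUnit, 𝒮.cone_adj hY₁]
    have hx : (Y₁ - diagUnit 𝒮.unit p).map J.mkQ = x := by
      rw [Matrix.map_sub _ (map_sub _), hx₁, diagUnit_map]; simp
    refine ⟨_, hs, hx, fun ε hε => ?_⟩
    obtain ⟨Y, hY, hxY⟩ := h ε hε
    refine ⟨Y - ((ε : ℂ) • diagUnit 𝒮.unit p + (Y₁ - diagUnit 𝒮.unit p)), ?_, fun i j => ?_, ?_⟩
    · rw [matAdj_sub, matAdj_add, hs, matAdj_smul, matAdj_diagUnit, 𝒮.cone_adj hY]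
    · rw [← Submodule.ker_mkQ J, LinearMap.mem_ker]
      have : (Y - ((ε : ℂ) • diagUnit 𝒮.unit p + (Y₁ - diagUnit 𝒮.unit p))).map J.mkQ = 0 := by
        rw [Matrix.map_sub _ (map_sub _), map_smul_add, hx, hxY, diagUnit_map, sub_self]
      exact congrFun (congrFun this i) j
    · simpa using hY

lemma IsCP.map_adj {𝒮 : OperatorSystem V} {𝒯 : OperatorSystem W} {φ : V →ₗ[ℂ] W}
    (h : 𝒮.IsCP 𝒯 φ) (x : V) : φ (𝒮.adj x) = 𝒯.adj (φ x) := by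
  have key : ∀ y : V, 𝒮.adj y = y → 𝒯.adj (φ y) = φ y := by
    intro y hy
    obtain ⟨r, -, hr⟩ := 𝒮.order_unit (p := 1) (Matrix.of fun _ _ => y)
      (by ext i j; simp [matAdj, hy])
    have h1 := congrFun (congrFun (𝒯.cone_adj (h 1 _ hr)) 0) 0
    have h2 := congrFun (congrFun (𝒯.cone_adj (h 1 _ (𝒮.unit_mem 1))) 0) 0
    simp only [matAdj, diagUnit, Matrix.of_apply, Matrix.map_apply, Matrix.add_apply,
      Matrix.smul_apply, Matrix.diagonal_apply_eq, map_add, map_smul, map_smulₛₗ,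
      Complex.conj_ofReal] at h1 h2
    rw [h2] at h1
    exact add_left_cancel h1
  have h1 := key (x + 𝒮.adj x) (by rw [map_add, 𝒮.adj_adj, add_comm])
  have h2 := key (Complex.I • (x - 𝒮.adj x)) (by
    rw [map_smulₛₗ, map_sub, 𝒮.adj_adj, Complex.conj_I, neg_smul, ← smul_neg, neg_sub])
  simp only [map_add, map_smul, map_smulₛₗ, map_sub, Complex.conj_I, neg_smul, ← smul_neg,
    neg_sub] at h1 h2
  have h3 := smul_right_injective W Complex.I_ne_zero h2
  have h4 : (2 : ℂ) • φ (𝒮.adj x) = (2 : ℂ) • 𝒯.adj (φ x) := by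
    rw [two_smul, two_smul]
    have h5 := congrArg₂ (· - ·) h1 h3
    have e1 : 𝒯.adj (φ x) + 𝒯.adj (φ (𝒮.adj x)) - (𝒯.adj (φ (𝒮.adj x)) - 𝒯.adj (φ x)) =
      𝒯.adj (φ x) + 𝒯.adj (φ x) := by abel
    have e2 : φ x + φ (𝒮.adj x) - (φ x - φ (𝒮.adj x)) = φ (𝒮.adj x) + φ (𝒮.adj x) := by abel
    rw [e1, e2] at h5
    exact h5.symm
  exact smul_right_injective W two_ne_zero h4

lemma IsKernel.adj_mem {𝒮 : OperatorSystem V} {J : Submodule ℂ V} (hJ : 𝒮.IsKernel J) :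
    J ≤ J.comap 𝒮.adj := by
  obtain ⟨W, _, _, 𝒯, φ, hφ, rfl⟩ := hJ
  intro x hx
  rw [LinearMap.mem_ker] at hx
  simp [hφ.map_adj, hx]

/-- The linear map induced by a completely positive map on the quotient by its kernel maps the
cones `C_p` to positive matrices. -/
lemma IsCP.liftQ_mem {𝒮 : OperatorSystem V} {𝒯 : OperatorSystem W} {φ : V →ₗ[ℂ] W}
    (h : 𝒮.IsCP 𝒯 φ) {p : ℕ} {x : Matrix (Fin p) (Fin p) (V ⧸ LinearMap.ker φ)}
    (hx : x ∈ 𝒮.C (LinearMap.ker φ) p) :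
    x.map ((LinearMap.ker φ).liftQ φ le_rfl) ∈ 𝒯.cone p := by
  rw [C_mem_iff] at hx
  refine 𝒯.archimedean _ fun ε hε => ?_
  have h1 : matAdj 𝒯.adj (-diagUnit (φ 𝒮.unit) p) = -diagUnit (φ 𝒮.unit) p := by
    have := 𝒯.cone_adj (h p _ (𝒮.unit_mem p))
    rw [diagUnit_map] at this
    rw [← zero_sub, matAdj_sub, this]
    congr 1; ext i j; simp [matAdj]
  obtain ⟨r, hr, hru⟩ := 𝒯.order_unit _ h1
  obtain ⟨Y, hY, hYx⟩ := hx (ε / r) (by positivity)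
  have h2 := h p Y hY
  have h3 : Y.map φ = ((ε / r : ℝ) : ℂ) • diagUnit (φ 𝒮.unit) p +
      x.map ((LinearMap.ker φ).liftQ φ le_rfl) := by
    have := congrArg (fun M => Matrix.map M ((LinearMap.ker φ).liftQ φ le_rfl)) hYx
    simp only [map_smul_add, diagUnit_map, Matrix.map_map] at this
    exact this
  have h4 := 𝒯.cone_add (𝒯.cone_smul (ε / r) (by positivity) hru) h2
  rw [h3, smul_add, smul_smul, ← Complex.ofReal_mul, div_mul_cancel₀ _ hr.ne'] at h4
  simpa using h4

/-- The quotient operator system `(S/J, {C_p(S/J)}, q(1))` of an operator system by a kernel. -/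
def quotient (𝒮 : OperatorSystem V) (J : Submodule ℂ V) (hJ : 𝒮.IsKernel J) :
    OperatorSystem (V ⧸ J) where
  adj := J.mapQ J 𝒮.adj hJ.adj_mem
  adj_adj x := by
    obtain ⟨x, rfl⟩ := Submodule.Quotient.mk_surjective J x
    simp [𝒮.adj_adj]
  unit := J.mkQ 𝒮.unit
  adj_unit := by simp [𝒮.adj_unit]
  cone p := 𝒮.C J p
  cone_adj := by
    rintro p x ⟨H, hH, rfl, -⟩
    ext i j
    have := congrFun (congrFun hH i) j
    simp only [matAdj, Matrix.of_apply] at this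
    simp [matAdj, this]
  cone_add := by
    intro p x y hx hy
    rw [C_mem_iff] at *
    intro ε hε
    obtain ⟨X, hX, hXx⟩ := hx (ε / 2) (by positivity)
    obtain ⟨Y, hY, hYy⟩ := hy (ε / 2) (by positivity)
    refine ⟨X + Y, 𝒮.cone_add hX hY, ?_⟩
    rw [Matrix.map_add _ (map_add _), hXx, hYy, add_add_add_comm, ← add_smul, ← Complex.ofReal_add,
      add_halves]
  cone_compress := by
    intro p q a x hx
    rw [C_mem_iff] at *
    intro ε hε
    have hs : matAdj 𝒮.adj (-compress a (diagUnit 𝒮.unit p)) =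
        -compress a (diagUnit 𝒮.unit p) := by
      rw [← zero_sub, matAdj_sub, matAdj_compress, matAdj_diagUnit]
      congr 1; ext i j; simp [matAdj]
    obtain ⟨r, hr, hru⟩ := 𝒮.order_unit _ hs
    obtain ⟨Y, hY, hYx⟩ := hx (ε / r) (by positivity)
    refine ⟨_, 𝒮.cone_add (𝒮.cone_smul (ε / r) (by positivity) hru) (𝒮.cone_compress a hY), ?_⟩
    rw [map_smul_add, map_smul_add, compress_map, hYx, compress_add, compress_smul, smul_add,
      smul_smul, ← Complex.ofReal_mul, div_mul_cancel₀ _ hr.ne', diagUnit_map,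
      Matrix.map_neg _ (map_neg _), compress_map, diagUnit_map, smul_neg]
    abel
  cone_proper := by
    obtain ⟨W, _, _, 𝒯, φ, hφ, rfl⟩ := hJ
    intro p x hx hx'
    have h1 := hφ.liftQ_mem hx
    have h2 := hφ.liftQ_mem hx'
    rw [Matrix.map_neg _ (map_neg _)] at h2
    have h3 := 𝒯.cone_proper h1 h2
    ext i j
    have h4 := congrFun (congrFun h3 i) j
    have : LinearMap.ker ((LinearMap.ker φ).liftQ φ le_rfl) = ⊥ :=
      Submodule.ker_liftQ_eq_bot _ _ _ le_rfl
    exact (LinearMap.ker_eq_bot'.1 this) _ h4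
  order_unit := by
    intro p x hx
    choose H hH using fun i j => Submodule.Quotient.mk_surjective J (x i j)
    have hHx : (Matrix.of H).map J.mkQ = x := by ext i j; simp [hH]
    have hHx' : (matAdj 𝒮.adj (Matrix.of H)).map J.mkQ = x := by
      conv_rhs => rw [← hx]
      ext i j; simp [matAdj, ← hH]
    obtain ⟨r, hr, h⟩ := 𝒮.order_unit
      (((1 / 2 : ℝ) : ℂ) • (Matrix.of H + matAdj 𝒮.adj (Matrix.of H)))
      (by rw [matAdj_smul, matAdj_add, matAdj_matAdj, add_comm])
    refine ⟨r, hr, ?_⟩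
    rw [C_mem_iff]
    intro ε hε
    refine ⟨_, 𝒮.cone_add (𝒮.cone_smul ε hε.le (𝒮.unit_mem p)) h, ?_⟩
    rw [map_smul_add, map_smul_add, diagUnit_map]
    congr 2
    ext i j
    have h1 := congrFun (congrFun hHx i) j
    have h2 := congrFun (congrFun hHx' i) j
    simp only [Matrix.map_apply] at h1 h2
    simp only [Matrix.map_apply, Matrix.smul_apply, Matrix.add_apply, map_smul, map_add, h1, h2]
    rw [← two_smul ℂ (x i j), smul_smul]
    norm_num
  archimedean := by
    intro p x hx
    rw [C_mem_iff]
    intro ε hε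
    obtain ⟨Y, hY, hYx⟩ := (C_mem_iff 𝒮 J _).1 (hx (ε / 2) (by positivity)) (ε / 2) (by positivity)
    refine ⟨Y, hY, ?_⟩
    rw [hYx, ← add_assoc, ← add_smul, ← Complex.ofReal_add, add_halves]

lemma IsCP.isKernel {W : Type u} [AddCommGroup W] [Module ℂ W] {𝒮 : OperatorSystem V}
    {𝒯 : OperatorSystem W} {φ : V →ₗ[ℂ] W} (h : 𝒮.IsCP 𝒯 φ) : 𝒮.IsKernel (LinearMap.ker φ) :=
  ⟨W, _, _, 𝒯, φ, h, rfl⟩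

/-- `φ` is a complete quotient map: it is completely positive and the induced linear map
`S / ker φ → T` is a complete order isomorphism from the quotient operator system onto `T`. -/
def IsCompleteQuotientMap {W : Type u} [AddCommGroup W] [Module ℂ W] (𝒮 : OperatorSystem V)
    (𝒯 : OperatorSystem W) (φ : V →ₗ[ℂ] W) : Prop :=
  ∃ h : 𝒮.IsCP 𝒯 φ, (𝒮.quotient (LinearMap.ker φ) h.isKernel).IsCompleteOrderIso 𝒯
    ((LinearMap.ker φ).liftQ φ le_rfl)

end OperatorSystem

/-! ### Concrete operator systems in C*-algebras -/

namespace OperatorSystem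

section general

variable {E : Type*} [CStarAlgebra E] [PartialOrder E] [StarOrderedRing E]

lemma nonneg_iff_exists (x : E) : 0 ≤ x ↔ ∃ y, x = star y * y :=
  CStarAlgebra.nonneg_iff_eq_star_mul_self

lemma exists_smul_one_add_nonneg (x : E) (hx : star x = x) :
    ∃ r : ℝ, 0 < r ∧ 0 ≤ (r : ℂ) • (1 : E) + x := by
  have hx' : IsSelfAdjoint x := hx
  refine ⟨‖x‖ + 1, by positivity, ?_⟩
  have h1 : -(algebraMap ℝ E ‖x‖) ≤ x := hx'.neg_algebraMap_norm_le_self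
  have h2 : (0 : E) ≤ algebraMap ℝ E ‖x‖ + x := by
    simpa using add_le_add_right h1 (algebraMap ℝ E ‖x‖)
  have h3 : ((‖x‖ + 1 : ℝ) : ℂ) • (1 : E) + x = (algebraMap ℝ E ‖x‖ + x) + 1 := by
    rw [Algebra.algebraMap_eq_smul_one, Complex.coe_smul, add_smul, one_smul]
    abel
  rw [h3]
  exact add_nonneg h2 zero_le_one

lemma nonneg_of_forall_smul_one_add (x : E)
    (h : ∀ ε : ℝ, 0 < ε → 0 ≤ (ε : ℂ) • (1 : E) + x) : 0 ≤ x := by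
  have hl : Filter.Tendsto (fun ε : ℝ => (ε : ℂ) • (1 : E) + x) (nhdsWithin 0 (Set.Ioi 0))
      (nhds (((0 : ℝ) : ℂ) • (1 : E) + x)) := by
    apply Filter.Tendsto.mono_left _ nhdsWithin_le_nhds
    exact (Continuous.tendsto (by fun_prop) _)
  have := CStarAlgebra.isClosed_nonneg.mem_of_tendsto hl
    (Filter.eventually_of_mem self_mem_nhdsWithin fun ε hε => h ε hε)
  simpa using this

end general

section concrete

variable {A : Type u} [CStarAlgebra A]

/-- Positivity in the C*-algebra `M_p(A)`: `X = Y^* Y` for some `Y ∈ M_p(A)`. -/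
def IsPosMat {p : ℕ} (X : Matrix (Fin p) (Fin p) A) : Prop :=
  ∃ Y : Matrix (Fin p) (Fin p) A, X = Y.conjTranspose * Y

lemma isPosMat_iff [PartialOrder A] [StarOrderedRing A] {p : ℕ} (X : Matrix (Fin p) (Fin p) A) :
    IsPosMat X ↔ 0 ≤ CStarMatrix.ofMatrix X :=
  (nonneg_iff_exists (CStarMatrix.ofMatrix X)).symm

lemma isPosMat_rect [PartialOrder A] [StarOrderedRing A] {p q : ℕ}
    (Z : Matrix (Fin p) (Fin q) A) : IsPosMat (Z.conjTranspose * Z) := by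
  rcases q with _ | q
  · exact ⟨0, by ext i; exact i.elim0⟩
  let R : Fin p → Matrix (Fin (q + 1)) (Fin (q + 1)) A :=
    fun k => Matrix.of fun i j => if i = 0 then Z k j else 0
  have h1 : Z.conjTranspose * Z = ∑ k, (R k).conjTranspose * R k := by
    ext i j
    simp only [Matrix.mul_apply, Matrix.conjTranspose_apply, Matrix.sum_apply]
    refine Finset.sum_congr rfl fun k _ => ?_
    rw [Finset.sum_eq_single 0]
    · simp [R]
    · intro b _ hb; simp [R, hb]
    · simp
  rw [isPosMat_iff, h1]
  have h2 : CStarMatrix.ofMatrix (∑ k, (R k).conjTranspose * R k) =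
      ∑ k, CStarMatrix.ofMatrix ((R k).conjTranspose * R k) :=
    map_sum (CStarMatrix.ofMatrixₗ : Matrix (Fin (q + 1)) (Fin (q + 1)) A ≃ₗ[ℂ] _) _ _
  rw [h2]
  exact Finset.sum_nonneg fun k _ => (isPosMat_iff _).1 ⟨R k, rfl⟩

/-- The (concrete) operator system structure on a unital selfadjoint subspace `S` of a unital
C*-algebra `A`: the positive matrices over `S` are those that are positive in `M_p(A)`. -/
def ofSubspace (S : Submodule ℂ A) (h1 : (1 : A) ∈ S) (hs : ∀ x ∈ S, star x ∈ S) :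
    OperatorSystem S where
  adj :=
    { toFun := fun x => ⟨star x.1, hs x.1 x.2⟩
      map_add' := fun x y => Subtype.ext (star_add x.1 y.1)
      map_smul' := fun c x => Subtype.ext (star_smul c x.1) }
  adj_adj x := Subtype.ext (star_star x.1)
  unit := ⟨1, h1⟩
  adj_unit := Subtype.ext (star_one A)
  cone p := {X | IsPosMat (X.map S.subtype)}
  cone_adj := by
    rintro p X ⟨Y, hY⟩
    have h : (X.map S.subtype).conjTranspose = X.map S.subtype := by
      rw [hY, Matrix.conjTranspose_mul, Matrix.conjTranspose_conjTranspose]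
    ext i j
    exact congrFun (congrFun h i) j
  cone_add := by
    let _ := CStarAlgebra.spectralOrder A
    let _ := CStarAlgebra.spectralOrderedRing A
    intro p X Y hX hY
    rw [Set.mem_ofPred_eq, isPosMat_iff] at *
    exact add_nonneg hX hY
  cone_compress := by
    let _ := CStarAlgebra.spectralOrder A
    let _ := CStarAlgebra.spectralOrderedRing A
    rintro p q a X ⟨Y, hY⟩
    have h : (compress a X).map S.subtype =
        (Y * a.map (algebraMap ℂ A)).conjTranspose * (Y * a.map (algebraMap ℂ A)) := by
      rw [Matrix.conjTranspose_mul, ← Matrix.mul_assoc, Matrix.mul_assoc _ _ Y, ← hY]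
      ext k l
      simp only [compress, Matrix.map_apply, Matrix.of_apply, map_sum, map_smul, Matrix.mul_apply,
        Matrix.conjTranspose_apply, Finset.sum_mul]
      rw [Finset.sum_comm]
      refine Finset.sum_congr rfl fun i _ => Finset.sum_congr rfl fun j _ => ?_
      rw [← algebraMap_star_comm, ← Algebra.smul_def, ← Algebra.commutes, ← Algebra.smul_def,
        smul_smul, mul_comm]
      rfl
    rw [Set.mem_ofPred_eq, h]
    exact isPosMat_rect _
  cone_proper := by
    let _ := CStarAlgebra.spectralOrder A
    let _ := CStarAlgebra.spectralOrderedRing A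
    intro p X hX hX'
    rw [Set.mem_ofPred_eq, isPosMat_iff] at *
    have h : CStarMatrix.ofMatrix (X.map S.subtype) = 0 := by
      refine le_antisymm ?_ hX
      have h2 : CStarMatrix.ofMatrix ((-X).map S.subtype) =
        -CStarMatrix.ofMatrix (X.map S.subtype) := by ext i j; rfl
      rw [h2] at hX'
      exact neg_nonneg.1 hX'
    ext i j
    exact congrFun (congrFun h i) j
  order_unit := by
    let _ := CStarAlgebra.spectralOrder A
    let _ := CStarAlgebra.spectralOrderedRing A
    intro p X hX
    obtain ⟨r, hr, h⟩ := exists_smul_one_add_nonneg (CStarMatrix.ofMatrix (X.map S.subtype)) (by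
      ext i j
      exact congrArg Subtype.val (congrFun (congrFun hX i) j))
    refine ⟨r, hr, ?_⟩
    rw [Set.mem_ofPred_eq, isPosMat_iff, map_smul_add, diagUnit_map]
    exact h
  archimedean := by
    let _ := CStarAlgebra.spectralOrder A
    let _ := CStarAlgebra.spectralOrderedRing A
    intro p X hX
    rw [Set.mem_ofPred_eq, isPosMat_iff]
    refine nonneg_of_forall_smul_one_add _ fun ε hε => ?_
    have := hX ε hε
    rw [Set.mem_ofPred_eq, isPosMat_iff, map_smul_add, diagUnit_map] at this
    exact this

end concrete
end OperatorSystem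

/-- The complex group algebra `ℂ[G]`, which will carry its largest C*-seminorm. -/
def GroupStarAlg (G : Type*) [Group G] : Type _ := MonoidAlgebra ℂ G

namespace GroupStarAlg

variable {G : Type*} [Group G]

instance : Ring (GroupStarAlg G) := inferInstanceAs (Ring (MonoidAlgebra ℂ G))
instance : Algebra ℂ (GroupStarAlg G) := inferInstanceAs (Algebra ℂ (MonoidAlgebra ℂ G))

/-- The element `c g` of the group algebra. -/
def single (g : G) (c : ℂ) : GroupStarAlg G := MonoidAlgebra.single g c

lemma single_mul (g h : G) (c d : ℂ) : single g c * single h d = single (g * h) (c * d) :=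
  MonoidAlgebra.single_mul_single ..

lemma single_one_one : single (1 : G) 1 = 1 := rfl

lemma smul_single (g : G) (c d : ℂ) : c • single g d = single g (c * d) :=
  MonoidAlgebra.smul_single ..

lemma single_zero (g : G) : single g 0 = 0 := MonoidAlgebra.single_zero ..

lemma single_add (g : G) (c d : ℂ) : single g (c + d) = single g c + single g d :=
  MonoidAlgebra.single_add ..

lemma induction {P : GroupStarAlg G → Prop} (x : GroupStarAlg G) (h0 : P 0)
    (ha : ∀ x y, P x → P y → P (x + y)) (hs : ∀ g c, P (single g c)) : P x :=
  MonoidAlgebra.induction_linear (motive := P) x h0 ha hs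

/-- The involution `∑ c_g g ↦ ∑ conj(c_g) g⁻¹`. -/
def starHom : GroupStarAlg G →+ GroupStarAlg G :=
  (Finsupp.liftAddHom fun g : G =>
    ({ toFun := fun c => single g⁻¹ (conj c)
       map_zero' := by rw [map_zero, single_zero]
       map_add' := fun c d => by rw [map_add, single_add] } : ℂ →+ GroupStarAlg G)).comp
    (MonoidAlgebra.coeffAddEquiv (R := ℂ) (M := G)).toAddMonoidHom

lemma starHom_single (g : G) (c : ℂ) : starHom (single g c) = single g⁻¹ (conj c) := by
  have := Finsupp.liftAddHom_apply_single (fun g : G =>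
    ({ toFun := fun c => single g⁻¹ (conj c)
       map_zero' := by rw [map_zero, single_zero]
       map_add' := fun c d => by rw [map_add, single_add] } : ℂ →+ GroupStarAlg G)) g c
  exact this

instance : StarRing (GroupStarAlg G) where
  star := starHom
  star_involutive x := by
    induction x using induction with
    | h0 => simp
    | ha x y hx hy => rw [map_add, map_add, hx, hy]
    | hs g c => simp [starHom_single]
  star_mul x y := by
    change starHom (x * y) = starHom y * starHom x
    induction x using induction with
    | h0 => simp
    | ha x x' hx hx' => rw [add_mul, map_add, map_add, mul_add, hx, hx']
    | hs g c =>
      induction y using induction with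
      | h0 => simp
      | ha x x' hx hx' => rw [mul_add, map_add, map_add, add_mul, hx, hx']
      | hs h d => simp [starHom_single, single_mul, mul_comm]
  star_add x y := map_add starHom x y

lemma star_single (g : G) (c : ℂ) : star (single g c) = single g⁻¹ (conj c) :=
  starHom_single g c

instance : StarModule ℂ (GroupStarAlg G) where
  star_smul c x := by
    induction x using induction with
    | h0 => simp
    | ha x y hx hy => rw [smul_add, star_add, star_add, smul_add, hx, hy]
    | hs g d => simp [star_single, smul_single]

/-- A C*-seminorm: a submultiplicative seminorm with `‖x^* x‖ = ‖x‖²`. -/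
structure CStarSeminorm (G : Type*) [Group G] extends Seminorm ℂ (GroupStarAlg G) where
  mul_le' : ∀ x y, toFun (x * y) ≤ toFun x * toFun y
  star_mul_self' : ∀ x, toFun (star x * x) = toFun x ^ 2

namespace CStarSeminorm

variable (p : CStarSeminorm G)

lemma mul_le (x y : GroupStarAlg G) : p.toSeminorm (x * y) ≤ p.toSeminorm x * p.toSeminorm y :=
  p.mul_le' x y

lemma star_mul_self (x : GroupStarAlg G) : p.toSeminorm (star x * x) = p.toSeminorm x ^ 2 :=
  p.star_mul_self' x

lemma map_star (x : GroupStarAlg G) : p.toSeminorm (star x) = p.toSeminorm x := by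
  have key : ∀ y : GroupStarAlg G, p.toSeminorm y ≤ p.toSeminorm (star y) := by
    intro y
    have h1 := p.star_mul_self y
    have h2 := p.mul_le (star y) y
    have h3 := apply_nonneg p.toSeminorm y
    have h4 := apply_nonneg p.toSeminorm (star y)
    rcases h3.eq_or_lt with h | h
    · rw [← h]; exact h4
    · nlinarith
  refine le_antisymm ?_ (key x)
  simpa using key (star x)

lemma single_le (g : G) (c : ℂ) : p.toSeminorm (single g c) ≤ ‖c‖ := by
  have h1 : p.toSeminorm (1 : GroupStarAlg G) ≤ 1 := by
    have h := p.star_mul_self (1 : GroupStarAlg G)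
    rw [star_one, one_mul] at h
    nlinarith [apply_nonneg p.toSeminorm (1 : GroupStarAlg G)]
  have h2 : p.toSeminorm (single g 1) ≤ 1 := by
    have h := p.star_mul_self (single g 1)
    rw [star_single, single_mul, inv_mul_cancel, map_one, one_mul, single_one_one] at h
    nlinarith [apply_nonneg p.toSeminorm (single g 1)]
  have h3 : single g c = c • single g (1 : ℂ) := by rw [smul_single, mul_one]
  rw [h3, map_smul_eq_mul]
  exact mul_le_of_le_one_right (norm_nonneg c) h2

end CStarSeminorm

instance : Inhabited (CStarSeminorm G) where
  default :=
    { toSeminorm := 0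
      mul_le' := fun x y => by
        change (0 : ℝ) ≤ 0 * 0
        simp
      star_mul_self' := fun x => by
        change (0 : ℝ) = 0 ^ 2
        simp }

lemma bddAbove (x : GroupStarAlg G) :
    BddAbove (Set.range fun p : CStarSeminorm G => p.toSeminorm x) := by
  induction x using induction with
  | h0 => exact ⟨0, by rintro _ ⟨p, rfl⟩; simp⟩
  | ha x y hx hy =>
    obtain ⟨a, ha⟩ := hx
    obtain ⟨b, hb⟩ := hy
    exact ⟨a + b, by
      rintro _ ⟨p, rfl⟩
      exact (map_add_le_add p.toSeminorm x y).trans (add_le_add (ha ⟨p, rfl⟩) (hb ⟨p, rfl⟩))⟩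
  | hs g c => exact ⟨‖c‖, by rintro _ ⟨p, rfl⟩; exact p.single_le g c⟩

/-- The full group C*-norm: the largest C*-seminorm on the group algebra. -/
def fullNorm (x : GroupStarAlg G) : ℝ := ⨆ p : CStarSeminorm G, p.toSeminorm x

lemma le_fullNorm (p : CStarSeminorm G) (x : GroupStarAlg G) : p.toSeminorm x ≤ fullNorm x :=
  le_ciSup (bddAbove x) p

lemma fullNorm_nonneg (x : GroupStarAlg G) : 0 ≤ fullNorm x :=
  (apply_nonneg (default : CStarSeminorm G).toSeminorm x).trans (le_fullNorm _ x)

lemma fullNorm_star (x : GroupStarAlg G) : fullNorm (star x) = fullNorm x := by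
  simp only [fullNorm, CStarSeminorm.map_star]

lemma fullNorm_star_mul_self (x : GroupStarAlg G) :
    fullNorm x * fullNorm x ≤ fullNorm (star x * x) := by
  have h : fullNorm x ≤ Real.sqrt (fullNorm (star x * x)) := by
    refine ciSup_le fun p => Real.le_sqrt_of_sq_le ?_
    rw [← p.star_mul_self]
    exact le_fullNorm p _
  calc fullNorm x * fullNorm x ≤ Real.sqrt (fullNorm (star x * x)) *
        Real.sqrt (fullNorm (star x * x)) :=
        mul_self_le_mul_self (fullNorm_nonneg x) h
    _ = _ := Real.mul_self_sqrt (fullNorm_nonneg _)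

/-- The full group C*-norm as a ring seminorm. -/
def fullRingSeminorm : RingSeminorm (GroupStarAlg G) where
  toFun := fullNorm
  map_zero' := by simp [fullNorm]
  add_le' x y := ciSup_le fun p => (map_add_le_add p.toSeminorm x y).trans
    (add_le_add (le_fullNorm p x) (le_fullNorm p y))
  neg' x := by simp [fullNorm]
  mul_le' x y := ciSup_le fun p => (p.mul_le x y).trans
    (mul_le_mul (le_fullNorm p x) (le_fullNorm p y) (apply_nonneg _ _) (fullNorm_nonneg x))

instance : SeminormedRing (GroupStarAlg G) := fullRingSeminorm.toSeminormedRing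

lemma norm_def (x : GroupStarAlg G) : ‖x‖ = fullNorm x := rfl

instance : NormedAlgebra ℂ (GroupStarAlg G) where
  norm_smul_le c x := by
    rw [norm_def, norm_def]
    refine ciSup_le fun p => ?_
    rw [map_smul_eq_mul]
    exact mul_le_mul_of_nonneg_left (le_fullNorm p x) (norm_nonneg c)

instance : NormedStarGroup (GroupStarAlg G) where
  norm_star_le x := (fullNorm_star x).le

lemma uniformContinuous_star : UniformContinuous (star : GroupStarAlg G → GroupStarAlg G) :=
  (starNormedAddGroupHom (E := GroupStarAlg G)).uniformContinuous

end GroupStarAlg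

/-- The full group C*-algebra `C*(G)`: the completion of the group algebra (modulo null vectors)
for its largest C*-seminorm. -/
def FullGroupCStar (G : Type*) [Group G] : Type _ := UniformSpace.Completion (GroupStarAlg G)

namespace FullGroupCStar

open UniformSpace

variable {G : Type*} [Group G]

instance : NormedRing (FullGroupCStar G) :=
  inferInstanceAs (NormedRing (Completion (GroupStarAlg G)))

instance : CompleteSpace (FullGroupCStar G) :=
  inferInstanceAs (CompleteSpace (Completion (GroupStarAlg G)))

instance : Algebra ℂ (FullGroupCStar G) :=
  inferInstanceAs (Algebra ℂ (Completion (GroupStarAlg G)))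

instance : NormedAlgebra ℂ (FullGroupCStar G) where
  norm_smul_le := norm_smul_le (α := ℂ) (β := Completion (GroupStarAlg G))

/-- The canonical map of the group algebra into `C*(G)`. -/
def ofAlg : GroupStarAlg G →ₐ[ℂ] FullGroupCStar G where
  toFun x := (x : Completion (GroupStarAlg G))
  map_one' := rfl
  map_mul' x y := Completion.coe_mul x y
  map_zero' := rfl
  map_add' x y := Completion.coe_add x y
  commutes' _ := rfl

lemma norm_ofAlg (x : GroupStarAlg G) : ‖ofAlg x‖ = ‖x‖ := Completion.norm_coe x

lemma continuous_ofAlg : Continuous (ofAlg : GroupStarAlg G → FullGroupCStar G) :=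
  Completion.continuous_coe _

lemma denseRange_ofAlg : DenseRange (ofAlg : GroupStarAlg G → FullGroupCStar G) :=
  Completion.denseRange_coe

instance : Star (FullGroupCStar G) where
  star := Completion.map (star : GroupStarAlg G → GroupStarAlg G)

lemma star_ofAlg (x : GroupStarAlg G) : star (ofAlg x) = ofAlg (star x) :=
  Completion.map_coe GroupStarAlg.uniformContinuous_star x

lemma continuous_star' : Continuous (star : FullGroupCStar G → FullGroupCStar G) :=
  Completion.continuous_map

instance : StarRing (FullGroupCStar G) where
  star_involutive x := by
    refine denseRange_ofAlg.induction_on (p := fun x => star (star x) = x) x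
      (isClosed_eq (continuous_star'.comp continuous_star') continuous_id) fun x => ?_
    rw [star_ofAlg, star_ofAlg, star_star]
  star_mul x y := by
    refine denseRange_ofAlg.induction_on₂ (p := fun x y => star (x * y) = star y * star x)
      (isClosed_eq (continuous_star'.comp continuous_mul)
        ((continuous_star'.comp continuous_snd).mul (continuous_star'.comp continuous_fst)))
      (fun x y => ?_) x y
    rw [← map_mul, star_ofAlg, star_ofAlg, star_ofAlg, star_mul, map_mul]
  star_add x y := by
    refine denseRange_ofAlg.induction_on₂ (p := fun x y => star (x + y) = star x + star y)
      (isClosed_eq (continuous_star'.comp continuous_add)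
        ((continuous_star'.comp continuous_fst).add (continuous_star'.comp continuous_snd)))
      (fun x y => ?_) x y
    rw [← map_add, star_ofAlg, star_ofAlg, star_ofAlg, star_add, map_add]

instance : StarModule ℂ (FullGroupCStar G) where
  star_smul c x := by
    refine denseRange_ofAlg.induction_on (p := fun x => star (c • x) = star c • star x) x
      (isClosed_eq (continuous_star'.comp (continuous_const_smul c))
        ((continuous_const_smul (star c)).comp continuous_star')) fun x => ?_
    rw [← map_smul, star_ofAlg, star_ofAlg, star_smul, map_smul]

instance : CStarRing (FullGroupCStar G) where
  norm_mul_self_le x := by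
    refine denseRange_ofAlg.induction_on (p := fun x => ‖x‖ * ‖x‖ ≤ ‖star x * x‖) x
      (isClosed_le (continuous_norm.mul continuous_norm)
        (continuous_norm.comp (continuous_star'.mul continuous_id))) fun x => ?_
    rw [star_ofAlg, ← map_mul, norm_ofAlg, norm_ofAlg]
    exact GroupStarAlg.fullNorm_star_mul_self x

instance : CStarAlgebra (FullGroupCStar G) where

/-- The canonical unitary of `C*(G)` attached to `g`. -/
def of (g : G) : FullGroupCStar G := ofAlg (GroupStarAlg.single g 1)

end FullGroupCStar

/-- The family `u` consists of universal unitaries that generate the unital C*-algebra `A`: every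
family of unitaries of the same size in a unital C*-algebra is the image of `u` under a unital
`*`-homomorphism. (Target algebras in the universe of `A` already determine the pair `(A, u)` up to
isomorphism.) -/
structure IsUniversalUnitaries {A : Type} [CStarAlgebra A] {ι : Type*} (u : ι → A) : Prop where
  unitary : ∀ i, u i ∈ unitary A
  generate : (StarAlgebra.adjoin ℂ (Set.range u)).topologicalClosure = ⊤
  universal : ∀ (B : Type) [CStarAlgebra B] (v : ι → B), (∀ i, v i ∈ _root_.unitary B) →
    ∃ π : A →⋆ₐ[ℂ] B, ∀ i, π (u i) = v i

namespace GroupStarAlg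

variable {G : Type*} [Group G] {B : Type*} [CStarAlgebra B]

/-- The `*`-representation of the group algebra induced by a unitary representation. -/
def rep (F : G →* unitary B) : GroupStarAlg G →ₐ[ℂ] B :=
  MonoidAlgebra.lift ℂ B G ((unitary B).subtype.comp F)

lemma rep_single (F : G →* unitary B) (g : G) (c : ℂ) : rep F (single g c) = c • (F g : B) :=
  MonoidAlgebra.lift_single ..

lemma rep_star (F : G →* unitary B) (x : GroupStarAlg G) : rep F (star x) = star (rep F x) := by
  induction x using induction with
  | h0 => simp
  | ha x y hx hy => rw [star_add, map_add, map_add, star_add, hx, hy]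
  | hs g c =>
    rw [star_single, rep_single, rep_single, star_smul, map_inv, ← Unitary.star_eq_inv]
    rfl

lemma norm_rep_le (F : G →* unitary B) (x : GroupStarAlg G) : ‖rep F x‖ ≤ ‖x‖ :=
  le_fullNorm
    { toSeminorm := (normSeminorm ℂ B).comp (rep F).toLinearMap
      mul_le' := fun x y => by
        change ‖rep F (x * y)‖ ≤ ‖rep F x‖ * ‖rep F y‖
        rw [map_mul]
        exact norm_mul_le _ _
      star_mul_self' := fun x => by
        change ‖rep F (star x * x)‖ = ‖rep F x‖ ^ 2
        rw [map_mul, rep_star, CStarRing.norm_star_mul_self, sq] } x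

end GroupStarAlg

namespace FullGroupCStar

open UniformSpace

variable {G : Type*} [Group G]

lemma of_mul (g h : G) : of (g * h) = of g * of h := by
  rw [of, of, of, ← map_mul, GroupStarAlg.single_mul, one_mul]

lemma of_one : of (1 : G) = 1 := rfl

lemma star_of (g : G) : star (of g) = of g⁻¹ := by
  rw [of, of, star_ofAlg, GroupStarAlg.star_single, map_one]

/-- The universal property of `C*(G)`: unitary representations of `G` extend. -/
lemma exists_lift {B : Type*} [CStarAlgebra B] (F : G →* unitary B) :
    ∃ π : FullGroupCStar G →⋆ₐ[ℂ] B, ∀ g, π (of g) = (F g : B) := by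
  have hc : Continuous (GroupStarAlg.rep F) :=
    AddMonoidHomClass.continuous_of_bound (GroupStarAlg.rep F) 1
      (fun x => by rw [one_mul]; exact GroupStarAlg.norm_rep_le F x)
  let ρ : FullGroupCStar G →+* B :=
    Completion.extensionHom (GroupStarAlg.rep F : GroupStarAlg G →+* B) hc
  have hρ : ∀ x, ρ (ofAlg x) = GroupStarAlg.rep F x :=
    Completion.extensionHom_coe (GroupStarAlg.rep F : GroupStarAlg G →+* B) hc
  have hρc : Continuous ρ := Completion.continuous_extension
  refine ⟨{ ρ with
            commutes' := fun c => ?_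
            map_star' := fun x => ?_ }, fun g => ?_⟩
  · change ρ (algebraMap ℂ _ c) = _
    rw [← ofAlg.commutes c, hρ, AlgHom.commutes]
  · change ρ (star x) = star (ρ x)
    refine denseRange_ofAlg.induction_on (p := fun x => ρ (star x) = star (ρ x)) x
      (isClosed_eq (hρc.comp continuous_star') (continuous_star.comp hρc)) fun x => ?_
    rw [star_ofAlg, hρ, hρ, GroupStarAlg.rep_star]
  · change ρ (of g) = _
    rw [of, hρ, GroupStarAlg.rep_single, one_smul]

end FullGroupCStar

/-- The free generators are universal unitaries that generate `C*(F)`. -/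
theorem isUniversalUnitaries_of (ι : Type) :
    IsUniversalUnitaries fun i : ι => FullGroupCStar.of (FreeGroup.of i) where
  unitary i := by
    rw [Unitary.mem_iff, FullGroupCStar.star_of, ← FullGroupCStar.of_mul, ← FullGroupCStar.of_mul,
      inv_mul_cancel, mul_inv_cancel, FullGroupCStar.of_one]
    exact ⟨rfl, rfl⟩
  generate := by
    set S := StarAlgebra.adjoin ℂ (Set.range fun i : ι => FullGroupCStar.of (FreeGroup.of i))
    have h1 : ∀ g : FreeGroup ι, FullGroupCStar.of g ∈ S := by
      intro g
      induction g using FreeGroup.induction_on with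
      | C1 => exact one_mem S
      | of i => exact StarAlgebra.subset_adjoin ℂ _ ⟨i, rfl⟩
      | inv_of i hi =>
        rw [← FullGroupCStar.star_of]
        exact star_mem hi
      | mul g h hg hh =>
        rw [FullGroupCStar.of_mul]
        exact mul_mem hg hh
    have h2 : ∀ x : GroupStarAlg (FreeGroup ι), FullGroupCStar.ofAlg x ∈ S := by
      intro x
      induction x using GroupStarAlg.induction with
      | h0 => rw [map_zero]; exact zero_mem S
      | ha x y hx hy => rw [map_add]; exact add_mem hx hy
      | hs g c =>
        have : GroupStarAlg.single g c = c • GroupStarAlg.single g (1 : ℂ) := by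
          rw [GroupStarAlg.smul_single, mul_one]
        rw [this, map_smul]
        exact SMulMemClass.smul_mem c (h1 g)
    refine eq_top_iff.2 fun x _ => ?_
    have h3 := FullGroupCStar.denseRange_ofAlg x
    refine closure_mono ?_ h3
    rintro _ ⟨y, rfl⟩
    exact h2 y
  universal B _ v hv := by
    obtain ⟨π, hπ⟩ := FullGroupCStar.exists_lift
      (FreeGroup.lift fun i => (⟨v i, hv i⟩ : _root_.unitary B))
    exact ⟨π, fun i => by rw [hπ, FreeGroup.lift_apply_of]⟩

/-! ### Tridiagonal matrices and the map into the span of universal unitaries -/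

namespace Tridiag

open scoped Matrix.Norms.L2Operator

/-- The tridiagonal matrices `T_n = {A ∈ M_n : A_{ij} = 0 whenever |i - j| ≥ 2}`. -/
def T (n : ℕ) : Submodule ℂ (Matrix (Fin n) (Fin n) ℂ) where
  carrier := {A | ∀ i j : Fin n, 2 ≤ |(i : ℤ) - (j : ℤ)| → A i j = 0}
  zero_mem' := fun _ _ _ => rfl
  add_mem' := fun hA hB i j h => by rw [Matrix.add_apply, hA i j h, hB i j h, add_zero]
  smul_mem' := fun c A hA i j h => by rw [Matrix.smul_apply, hA i j h, smul_zero]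

/-- The diagonal matrices of trace zero, `J_n ⊆ M_n`. -/
def J (n : ℕ) : Submodule ℂ (Matrix (Fin n) (Fin n) ℂ) where
  carrier := {A | A.IsDiag ∧ A.trace = 0}
  zero_mem' := ⟨Matrix.isDiag_zero, Matrix.trace_zero _ _⟩
  add_mem' := fun hA hB => ⟨hA.1.add hB.1, by rw [Matrix.trace_add, hA.2, hB.2, add_zero]⟩
  smul_mem' := fun c A hA => ⟨hA.1.smul c, by rw [Matrix.trace_smul, hA.2, smul_zero]⟩

/-- `T_n` as an operator system in the C*-algebra `M_n`. -/
def TSys (n : ℕ) : OperatorSystem (T n) :=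
  OperatorSystem.ofSubspace (T n)
    (fun i j h => Matrix.one_apply_ne (by rintro rfl; simp at h))
    (fun A hA i j h => by
      rw [Matrix.star_apply, hA j i (by rwa [abs_sub_comm]), star_zero])

variable {A : Type} [CStarAlgebra A]

/-- The span of `1`, the `u_j` and the `u_j^*`. -/
def S {k : ℕ} (u : Fin k → A) : Submodule ℂ A :=
  Submodule.span ℂ ({1} ∪ Set.range u ∪ Set.range fun j => star (u j))

lemma one_mem_S {k : ℕ} (u : Fin k → A) : (1 : A) ∈ S u :=
  Submodule.subset_span (Or.inl (Or.inl rfl))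

lemma mem_S {k : ℕ} (u : Fin k → A) (j : Fin k) : u j ∈ S u :=
  Submodule.subset_span (Or.inl (Or.inr ⟨j, rfl⟩))

lemma star_mem_S {k : ℕ} (u : Fin k → A) (j : Fin k) : star (u j) ∈ S u :=
  Submodule.subset_span (Or.inr ⟨j, rfl⟩)

lemma S_star {k : ℕ} (u : Fin k → A) : ∀ x ∈ S u, star x ∈ S u := by
  intro x hx
  induction hx using Submodule.span_induction with
  | mem x h =>
    rcases h with (h | ⟨j, rfl⟩) | ⟨j, rfl⟩
    · rw [Set.mem_singleton_iff] at h
      rw [h, star_one]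
      exact one_mem_S u
    · exact star_mem_S u j
    · rw [star_star]
      exact mem_S u j
  | zero => rw [star_zero]; exact zero_mem _
  | add x y _ _ hx hy => rw [star_add]; exact add_mem hx hy
  | smul c x _ hx => rw [star_smul]; exact Submodule.smul_mem _ _ hx

/-- The span of `1`, the `u_j` and the `u_j^*`, as an operator system in the C*-algebra `A`. -/
def SSys {k : ℕ} (u : Fin k → A) : OperatorSystem (S u) :=
  OperatorSystem.ofSubspace (S u) (one_mem_S u) (S_star u)

/-- `1` on the diagonal, `u_i` at `(i, i + 1)`, `u_i^*` at `(i + 1, i)`, and `0` elsewhere. -/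
def band {n : ℕ} (u : Fin (n - 1) → A) (i j : Fin n) : A :=
  if i = j then 1
  else if h : i.val + 1 = j.val then u ⟨i.val, by omega⟩
  else if h : j.val + 1 = i.val then star (u ⟨j.val, by omega⟩)
  else 0

lemma band_mem {n : ℕ} (u : Fin (n - 1) → A) (i j : Fin n) : band u i j ∈ S u := by
  unfold band
  split_ifs
  · exact one_mem_S u
  · exact mem_S u _
  · exact star_mem_S u _
  · exact zero_mem _

/-- The linear map `φ` with `φ(E_{ii}) = 1/n`, `φ(E_{i,i+1}) = u_i/n` and
`φ(E_{i+1,i}) = u_i^*/n`. -/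
def phi {n : ℕ} (u : Fin (n - 1) → A) : T n →ₗ[ℂ] S u where
  toFun X := ∑ i, ∑ j, (X.1 i j * (1 / (n : ℂ))) • ⟨band u i j, band_mem u i j⟩
  map_add' X Y := by
    simp only [Submodule.coe_add, Matrix.add_apply, add_mul, add_smul, Finset.sum_add_distrib]
  map_smul' c X := by
    simp only [Submodule.coe_smul, Matrix.smul_apply, smul_eq_mul, mul_assoc, mul_smul,
      Finset.smul_sum, RingHom.id_apply]

lemma single_mem_T {n : ℕ} (i j : Fin n) (h : |(i : ℤ) - (j : ℤ)| ≤ 1) :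
    Matrix.single i j (1 : ℂ) ∈ T n := by
  intro k l hkl
  refine Matrix.single_apply_of_ne _ _ _ _ _ ?_
  rintro ⟨rfl, rfl⟩
  omega

lemma phi_single {n : ℕ} (u : Fin (n - 1) → A) (i j : Fin n) (h : |(i : ℤ) - (j : ℤ)| ≤ 1) :
    (phi u ⟨Matrix.single i j 1, single_mem_T i j h⟩ : A) = (1 / (n : ℂ)) • band u i j := by
  simp only [phi, LinearMap.coe_mk, AddHom.coe_mk, AddSubmonoidClass.coe_finsetSum,
    Submodule.coe_smul]
  rw [Finset.sum_eq_single i, Finset.sum_eq_single j]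
  · simp
  · intro l _ hl
    simp [hl.symm]
  · simp
  · intro k _ hk
    simp [hk.symm]
  · simp

end Tridiag

end

/-! Two unitary constructions carry the proof, one for each direction of positivity.

Complete positivity of φ: put w_k = u_0 ⋯ u_{k-1}. Then w_k^* w_{k+1} = u_k, so on the tridiagonal
band φ(E_{kl}) = w_k^* w_l / n. Entries of X ∈ T_n off the band vanish, hence φ(X) = (1/n) ∑ X_{kl}
w_k^* w_l, and a factorization X = B^* B over M_p turns this into (1/n) Z^* Z (`isCP_phi`).

Lifting of positivity (`exists_add_mem_cone`): if X is selfadjoint and φ(X) is positive at level p,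
some K over J_n makes X + K positive. The matrices X for which such a K exists form a closed cone,
because adding K does not change the trace and the trace bounds a positive semidefinite matrix. By
Hahn–Banach it suffices to pair X with functionals that are positive and vanish on matrices over
J_n, that is, with Gram matrices of vectors y_{(a,k)} for which ⟨y_{(a,k)}, y_{(b,k)}⟩ does not
depend on k (`exists_posSemidef_add_blockTraceZero`). For each k the family (y_{(a,k)})_a then has
the Gram matrix of (y_{(a,0)})_a, so a unitary V_k carries one to the other. Universality gives a
representation π with π(u_j) = V_j^* V_{j+1}. The pairing becomes n ∑_{a,b} ⟨y_{(a,0)}, π(φ(X_{ab}))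
y_{(b,0)}⟩, which is nonnegative.

The lift uses no ε, so it yields order proximinality and complete positivity of the inverse at once.
Applied to X and −X, it also computes the kernel. -/

noncomputable section
open scoped ComplexConjugate

/-! ### Positive semidefinite matrices as Gram matrices. -/

namespace Matrix

variable {ι : Type*} [Fintype ι]

section

open scoped Matrix.Norms.L2Operator MatrixOrder ComplexOrder

lemma PosSemidef.exists_eq_conjTranspose_mul_self [DecidableEq ι] {M : Matrix ι ι ℂ}
    (hM : M.PosSemidef) : ∃ B : Matrix ι ι ℂ, M = Bᴴ * B :=
  CStarAlgebra.nonneg_iff_eq_star_mul_self.1 hM.nonneg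

end

open scoped ComplexOrder

/-- Every positive semidefinite matrix is a Gram matrix. -/
lemma PosSemidef.exists_gram [DecidableEq ι] {M : Matrix ι ι ℂ} (hM : M.PosSemidef) :
    ∃ y : ι → EuclideanSpace ℂ ι, ∀ i j, inner ℂ (y i) (y j) = M i j := by
  obtain ⟨B, rfl⟩ := hM.exists_eq_conjTranspose_mul_self
  refine ⟨fun i => WithLp.toLp 2 fun k => B k i, fun i j => ?_⟩
  simp [PiLp.inner_apply, Matrix.mul_apply, mul_comm]

/-- Cauchy–Schwarz in a Gram representation, where the trace is the sum of the squared norms of the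
vectors. It supplies the compactness behind the closed cone, and it shows that a positive matrix of
trace zero vanishes. -/
lemma PosSemidef.norm_apply_le_trace [DecidableEq ι] {M : Matrix ι ι ℂ} (hM : M.PosSemidef)
    (i j : ι) : ‖M i j‖ ≤ M.trace.re := by
  obtain ⟨y, hy⟩ := hM.exists_gram
  have h1 : ∀ i, ‖y i‖ ^ 2 ≤ M.trace.re := by
    intro i
    have h2 : ∀ k, (M k k).re = ‖y k‖ ^ 2 := fun k => by
      rw [← hy, inner_self_eq_norm_sq_to_K]
      norm_cast
    simp only [Matrix.trace, Matrix.diag, Complex.re_sum, h2]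
    exact Finset.single_le_sum (f := fun k => ‖y k‖ ^ 2) (fun k _ => by positivity)
      (Finset.mem_univ i)
  rw [← hy]
  refine (norm_inner_le_norm _ _).trans ?_
  nlinarith [h1 i, h1 j, sq_nonneg (‖y i‖ - ‖y j‖)]

lemma isClosed_posSemidef : IsClosed {M : Matrix ι ι ℂ | M.PosSemidef} := by
  simp only [posSemidef_iff_dotProduct_mulVec, Set.ofPred_and, Set.ofPred_forall]
  refine IsClosed.inter (isClosed_eq (by fun_prop) continuous_id) (isClosed_iInter fun x => ?_)
  refine isClosed_le continuous_const ?_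
  unfold dotProduct mulVec dotProduct
  fun_prop

/-! ### Duality for positivity modulo diagonal blocks of trace zero. -/

variable {κ : Type*} [Fintype κ]

/-- The matrices over `ι` with entries in the diagonal `κ × κ` matrices of trace zero. -/
def blockTraceZero (ι κ : Type*) [Fintype κ] : Submodule ℂ (Matrix (ι × κ) (ι × κ) ℂ) where
  carrier := {K | (∀ a b k l, k ≠ l → K (a, k) (b, l) = 0) ∧ ∀ a b, ∑ k, K (a, k) (b, k) = 0}
  zero_mem' := by simp
  add_mem' := by
    rintro K L ⟨h1, h2⟩ ⟨h3, h4⟩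
    exact ⟨fun a b k l h => by simp [h1 a b k l h, h3 a b k l h],
      fun a b => by simp [Finset.sum_add_distrib, h2, h4]⟩
  smul_mem' := by
    rintro c K ⟨h1, h2⟩
    exact ⟨fun a b k l h => by simp [h1 a b k l h], fun a b => by simp [← Finset.mul_sum, h2]⟩

lemma trace_eq_zero_of_mem_blockTraceZero {K : Matrix (ι × κ) (ι × κ) ℂ}
    (hK : K ∈ blockTraceZero ι κ) : K.trace = 0 := by
  simp only [Matrix.trace, Matrix.diag, Fintype.sum_prod_type]
  exact Finset.sum_eq_zero fun a _ => hK.2 a a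

open scoped Matrix.Norms.Elementwise Pointwise

/-- The cone of block matrices that become positive semidefinite after adding an element of
`blockTraceZero` is closed. -/
lemma isClosed_posSemidef_add_blockTraceZero [DecidableEq ι] [DecidableEq κ] :
    IsClosed {X : Matrix (ι × κ) (ι × κ) ℂ | ∃ K ∈ blockTraceZero ι κ, (X + K).PosSemidef} := by
  set Q := {X : Matrix (ι × κ) (ι × κ) ℂ | ∃ K ∈ blockTraceZero ι κ, (X + K).PosSemidef}
  refine isClosed_of_closure_subset fun x hx => ?_
  -- Closedness is local, so only matrices with trace below tr x + 1 matter. For these X + K has the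
  -- same trace as X and lies in the compact set `P`; compact plus closed subspace is closed.
  let U := {X : Matrix (ι × κ) (ι × κ) ℂ | X.trace.re < x.trace.re + 1}
  have htr : Continuous fun X : Matrix (ι × κ) (ι × κ) ℂ => X.trace.re := by
    unfold Matrix.trace; fun_prop
  have hU : IsOpen U := isOpen_lt htr continuous_const
  let P := {X : Matrix (ι × κ) (ι × κ) ℂ | X.PosSemidef ∧ X.trace.re ≤ x.trace.re + 1}
  have hP : IsCompact P := by
    refine Metric.isCompact_of_isClosed_isBounded
      (isClosed_posSemidef.inter (isClosed_le htr continuous_const)) ?_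
    refine (Metric.isBounded_closedBall (x := (0 : Matrix (ι × κ) (ι × κ) ℂ))
      (r := max 0 (x.trace.re + 1))).subset ?_
    rintro X ⟨h1, h2⟩
    rw [mem_closedBall_zero_iff, Matrix.norm_le_iff (le_max_left _ _)]
    exact fun i j => ((h1.norm_apply_le_trace i j).trans h2).trans (le_max_right _ _)
  have hK : IsClosed (blockTraceZero ι κ : Set (Matrix (ι × κ) (ι × κ) ℂ)) :=
    Submodule.closed_of_finiteDimensional _
  have h1 : IsClosed (P + (blockTraceZero ι κ : Set (Matrix (ι × κ) (ι × κ) ℂ))) :=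
    hK.add_left_of_isCompact hP
  have h2 : U ∩ Q ⊆ P + (blockTraceZero ι κ : Set (Matrix (ι × κ) (ι × κ) ℂ)) := by
    rintro X ⟨hX, K, hK, hXK⟩
    refine ⟨X + K, ⟨hXK, ?_⟩, -K, neg_mem hK, by simp⟩
    rw [Matrix.trace_add, trace_eq_zero_of_mem_blockTraceZero hK, add_zero]
    exact le_of_lt hX
  have h3 : x ∈ closure (U ∩ Q) := hU.inter_closure ⟨by simp [U], hx⟩
  obtain ⟨Y, hY, K, hK, rfl⟩ := closure_minimal h2 h1 h3
  exact ⟨-K, neg_mem hK, by simpa using hY.1⟩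

/-- A real functional on complex matrices is the real part of a complex bilinear pairing. -/
lemma realFunctional_eq [DecidableEq ι] (f : Matrix ι ι ℂ →ₗ[ℝ] ℝ) (X : Matrix ι ι ℂ) :
    f X = (∑ i, ∑ j, X i j *
      (f (single i j 1) - f (single i j Complex.I) * Complex.I : ℂ)).re := by
  conv_lhs => rw [matrix_eq_sum_single X]
  simp only [map_sum, Complex.re_sum]
  refine Finset.sum_congr rfl fun i _ => Finset.sum_congr rfl fun j _ => ?_
  -- Splitting z = X i j into real and imaginary parts: with α = f(E_{ij}) and β = f(i E_{ij}), real
  -- linearity gives α Re z + β Im z = Re(z (α − β i)).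
  have h : single i j (X i j) = (X i j).re • single i j (1 : ℂ) +
      (X i j).im • single i j Complex.I := by
    rw [smul_single, smul_single, ← single_add]
    congr 1
    simp [Complex.re_add_im]
  rw [h, map_add, map_smul, map_smul]
  simp

/-- If `H` pairs nonnegatively with all Gram matrices with constant diagonal blocks, then `H + K` is
positive for some block matrix `K` over the diagonal matrices of trace zero. -/
theorem exists_posSemidef_add_blockTraceZero [DecidableEq ι] [DecidableEq κ]
    (H : Matrix (ι × κ) (ι × κ) ℂ) (hH : H.IsHermitian)
    (h : ∀ y : ι × κ → EuclideanSpace ℂ (ι × κ),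
      (∀ a b k l, inner ℂ (y (a, k)) (y (b, k)) = inner ℂ (y (a, l)) (y (b, l))) →
      0 ≤ (∑ i, ∑ j, H i j * inner ℂ (y i) (y j)).re) :
    ∃ K ∈ blockTraceZero ι κ, (H + K).PosSemidef := by
  by_contra hcon
  -- If no such K exists, H lies outside this closed real cone, and a separating functional f has
  -- f(H) < 0 while f ≥ 0 on the cone.
  let Q : ProperCone ℝ (Matrix (ι × κ) (ι × κ) ℂ) :=
    { carrier := {X | ∃ K ∈ blockTraceZero ι κ, (X + K).PosSemidef}
      add_mem' := by
        rintro X Y ⟨K, hK, hX⟩ ⟨L, hL, hY⟩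
        exact ⟨K + L, add_mem hK hL, by rw [add_add_add_comm]; exact hX.add hY⟩
      zero_mem' := ⟨0, zero_mem _, by simpa using PosSemidef.zero⟩
      smul_mem' := by
        rintro ⟨c, hc⟩ X ⟨K, hK, hX⟩
        refine ⟨(c : ℂ) • K, Submodule.smul_mem _ _ hK, ?_⟩
        have := hX.smul (a := (c : ℂ)) (by exact_mod_cast hc)
        rw [smul_add] at this
        convert this using 2
        ext i j
        simp
      isClosed' := isClosed_posSemidef_add_blockTraceZero }
  have : LocallyConvexSpace ℝ (Matrix (ι × κ) (ι × κ) ℂ) :=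
    inferInstanceAs (LocallyConvexSpace ℝ (ι × κ → ι × κ → ℂ))
  obtain ⟨f, hf, hfH⟩ := Q.hyperplane_separation_point (x₀ := H) hcon
  -- Both K and −K belong to the cone, since each can be corrected to 0.
  have hfK : ∀ K ∈ blockTraceZero ι κ, f K = 0 := by
    intro K hK
    have h1 := hf K ⟨-K, neg_mem hK, by simpa using PosSemidef.zero⟩
    have h2 := hf (-K) ⟨K, hK, by simpa using PosSemidef.zero⟩
    rw [map_neg] at h2
    linarith
  have hfP : ∀ X : Matrix (ι × κ) (ι × κ) ℂ, X.PosSemidef → 0 ≤ f X :=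
    fun X hX => hf X ⟨0, zero_mem _, by simpa using hX⟩
  let G : Matrix (ι × κ) (ι × κ) ℂ :=
    of fun i j => (f (single i j 1) - f (single i j Complex.I) * Complex.I : ℂ)
  have hG : ∀ X, f X = (∑ i, ∑ j, X i j * G i j).re := realFunctional_eq f.toLinearMap
  -- The difference of the matrix units at ((a,k),(b,k)) and ((a,l),(b,l)), scaled by any z, lies in
  -- `blockTraceZero`, so f does not distinguish them.
  have hGc : ∀ a b k l, G (a, k) (b, k) = G (a, l) (b, l) := by
    intro a b k l
    have hz : ∀ z : ℂ, f (single (a, k) (b, k) z) = f (single (a, l) (b, l) z) := by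
      intro z
      rw [← sub_eq_zero, ← map_sub]
      refine hfK _ ⟨fun a' b' k' l' hkl => ?_, fun a' b' => ?_⟩
      · rw [sub_apply, single_apply_of_ne, single_apply_of_ne, sub_zero]
        · rintro ⟨h1, h2⟩; simp_all
        · rintro ⟨h1, h2⟩; simp_all
      · by_cases hab : a = a' ∧ b = b'
        · obtain ⟨rfl, rfl⟩ := hab
          simp [single_apply]
        · refine Finset.sum_eq_zero fun m _ => ?_
          rw [sub_apply, single_apply_of_ne, single_apply_of_ne, sub_zero]
          · rintro ⟨h1, h2⟩; simp_all
          · rintro ⟨h1, h2⟩; simp_all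
    simp only [G, of_apply, hz]
  -- The density `G` of f need not be Hermitian. Its Hermitian part represents f only on Hermitian
  -- matrices, which is enough for H and for the rank-one matrices that test positivity.
  let M : Matrix (ι × κ) (ι × κ) ℂ := (1 / 2 : ℂ) • (G + Gᴴ)
  have hMre : ∀ X : Matrix (ι × κ) (ι × κ) ℂ, X.IsHermitian →
      (∑ i, ∑ j, X i j * M i j).re = f X := by
    intro X hX
    have h1 : ∑ i, ∑ j, X i j * Gᴴ i j = conj (∑ i, ∑ j, X i j * G i j) := by
      rw [map_sum, Finset.sum_comm]
      refine Finset.sum_congr rfl fun i _ => ?_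
      rw [map_sum]
      refine Finset.sum_congr rfl fun j _ => ?_
      rw [← hX.apply j i]
      simp
    have h2 : ∑ i, ∑ j, X i j * M i j =
        (1 / 2 : ℂ) * (∑ i, ∑ j, X i j * G i j + ∑ i, ∑ j, X i j * Gᴴ i j) := by
      simp only [← Finset.sum_add_distrib, Finset.mul_sum]
      refine Finset.sum_congr rfl fun i _ => Finset.sum_congr rfl fun j _ => ?_
      simp only [M, smul_apply, add_apply, smul_eq_mul]
      ring
    rw [h2, h1, hG, Complex.add_conj]
    norm_cast
    simp
  have hMh : M.IsHermitian := by
    ext i j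
    simp [M, add_comm]
  have hM : M.PosSemidef := by
    refine PosSemidef.of_dotProduct_mulVec_nonneg hMh fun v => ?_
    -- The quadratic form of `M` at v is the pairing of `M` with this rank-one positive matrix,
    -- hence a value of f on the cone.
    have hX := posSemidef_vecMulVec_star_self v
    have h1 := hfP _ hX
    rw [← hMre _ hX.isHermitian] at h1
    have h2 : star v ⬝ᵥ M *ᵥ v = ∑ i, ∑ j, vecMulVec (star v) v i j * M i j := by
      simp only [dotProduct, mulVec, Finset.mul_sum, vecMulVec_apply]
      refine Finset.sum_congr rfl fun i _ => Finset.sum_congr rfl fun j _ => by ring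
    rw [Complex.nonneg_iff]
    refine ⟨by rw [h2]; exact h1, ?_⟩
    exact (hMh.im_star_dotProduct_mulVec_self v).symm
  obtain ⟨y, hy⟩ := hM.exists_gram
  have h1 := h y fun a b k l => by
    rw [hy, hy]
    simp only [M, smul_apply, add_apply, conjTranspose_apply]
    rw [hGc a b k l, hGc b a k l]
  simp only [hy] at h1
  rw [hMre H hH] at h1
  linarith

end Matrix

/-! ### Unitaries between families with equal Gram matrices. -/

/-- Two families with the same Gram matrix differ by a unitary. -/
lemma exists_linearIsometryEquiv_of_inner_eq {ι F : Type*} [Fintype ι] [NormedAddCommGroup F]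
    [InnerProductSpace ℂ F] [FiniteDimensional ℂ F] (x y : ι → F)
    (h : ∀ a b, inner ℂ (x a) (x b) = inner ℂ (y a) (y b)) :
    ∃ U : F ≃ₗᵢ[ℂ] F, ∀ a, U (x a) = y a := by
  let Lx := Fintype.linearCombination ℂ x
  let Ly := Fintype.linearCombination ℂ y
  -- Norms of linear combinations depend only on the Gram matrix, so ∑ c_a x_a ↦ ∑ c_a y_a is well
  -- defined and isometric on the span of the x_a.
  have hn : ∀ c, ‖Lx c‖ = ‖Ly c‖ := by
    intro c
    have h1 : inner ℂ (Lx c) (Lx c) = inner ℂ (Ly c) (Ly c) := by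
      simp only [Lx, Ly, Fintype.linearCombination_apply, sum_inner, inner_sum, inner_smul_left,
        inner_smul_right, h]
    rw [inner_self_eq_norm_sq_to_K, inner_self_eq_norm_sq_to_K] at h1
    have h2 : ‖Lx c‖ ^ 2 = ‖Ly c‖ ^ 2 := by exact_mod_cast h1
    exact (sq_eq_sq₀ (norm_nonneg _) (norm_nonneg _)).1 h2
  have hker : LinearMap.ker Lx ≤ LinearMap.ker Ly := fun c hc => by
    rw [LinearMap.mem_ker, ← norm_eq_zero] at hc ⊢
    rw [← hn, hc]
  let e := Lx.quotKerEquivRange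
  let L : LinearMap.range Lx →ₗ[ℂ] F := ((LinearMap.ker Lx).liftQ Ly hker) ∘ₗ e.symm.toLinearMap
  have hL : ∀ c (hc : Lx c ∈ LinearMap.range Lx), L ⟨Lx c, hc⟩ = Ly c := by
    intro c hc
    have : e.symm ⟨Lx c, hc⟩ = (LinearMap.ker Lx).mkQ c := by
      rw [LinearEquiv.symm_apply_eq]
      rfl
    simp [L, this]
  let Li : LinearMap.range Lx →ₗᵢ[ℂ] F :=
    { L with
      norm_map' := by
        rintro ⟨_, c, rfl⟩
        exact (congrArg norm (hL c ⟨c, rfl⟩)).trans (hn c).symm }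
  -- Finite dimension enters here: the partial isometry extends to all of F, and an isometry of F
  -- into itself is onto.
  refine ⟨Li.extend.toLinearIsometryEquiv rfl, fun a => ?_⟩
  classical
  have hxa : Lx (Pi.single a 1) = x a := by simp [Lx]
  have hya : Ly (Pi.single a 1) = y a := by simp [Ly]
  have h1 := Li.extend_apply ⟨Lx (Pi.single a 1), ⟨_, rfl⟩⟩
  have h2 : Li ⟨Lx (Pi.single a 1), ⟨_, rfl⟩⟩ = Ly (Pi.single a 1) := hL _ _
  rw [LinearIsometry.coe_toLinearIsometryEquiv, ← hxa, ← hya, ← h2, ← h1]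

/-! ### Positivity over T_n as positivity of scalar matrices. -/

namespace Tridiag

open OpSys OperatorSystem Matrix
open scoped Matrix.Norms.L2Operator ComplexOrder

/-- The matrix over `ℂ` obtained from a matrix over `T_n` by forgetting the block structure. -/
def flatten {n p : ℕ} (X : Matrix (Fin p) (Fin p) (T n)) :
    Matrix (Fin p × Fin n) (Fin p × Fin n) ℂ :=
  of fun i j => (X i.1 j.1).1 i.2 j.2

/-- M_p(M_n) and M_{pn} are the same *-algebra, and both sides ask for a factorization Y^* Y there.
The factor need not be tridiagonal, since the cone of T_n is inherited from M_n. -/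
lemma mem_cone_TSys_iff {n p : ℕ} (X : Matrix (Fin p) (Fin p) (T n)) :
    X ∈ (TSys n).cone p ↔ (flatten X).PosSemidef := by
  constructor
  · rintro ⟨Y, hY⟩
    have h : flatten X = (comp _ _ _ _ ℂ Y)ᴴ * comp _ _ _ _ ℂ Y := by
      ext ⟨a, k⟩ ⟨b, l⟩
      have h1 := congrFun (congrFun (congrFun (congrFun hY a) b) k) l
      simp only [map_apply, Submodule.subtype_apply] at h1
      simp only [flatten, of_apply, h1, Matrix.mul_apply, Matrix.sum_apply, conjTranspose_apply,
        Fintype.sum_prod_type, comp_apply, star_apply]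
    rw [h]
    exact posSemidef_conjTranspose_mul_self _
  · intro h
    obtain ⟨B, hB⟩ := h.exists_eq_conjTranspose_mul_self
    refine ⟨(comp _ _ _ _ ℂ).symm B, ?_⟩
    ext a b k l
    have h1 := congrFun (congrFun hB (a, k)) (b, l)
    simp only [flatten, of_apply] at h1
    simp only [map_apply, Submodule.subtype_apply, h1, Matrix.mul_apply, Matrix.sum_apply, conjTranspose_apply,
      Fintype.sum_prod_type, comp_symm_apply, star_apply]

lemma isHermitian_flatten {n p : ℕ} {X : Matrix (Fin p) (Fin p) (T n)}
    (hX : matAdj (TSys n).adj X = X) : (flatten X).IsHermitian := by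
  ext ⟨a, k⟩ ⟨b, l⟩
  exact congrFun (congrFun (congrArg Subtype.val (congrFun (congrFun hX a) b)) k) l

lemma J_le_T (n : ℕ) : J n ≤ T n := fun _ hA i j h => hA.1 (by rintro rfl; simp at h)

variable {A : Type} [CStarAlgebra A]

lemma coe_phi {n : ℕ} (u : Fin (n - 1) → A) (X : T n) :
    (phi u X : A) = (1 / (n : ℂ)) • ∑ k, ∑ l, X.1 k l • band u k l := by
  simp only [phi, LinearMap.coe_mk, AddHom.coe_mk, AddSubmonoidClass.coe_finsetSum,
    Submodule.coe_smul, Finset.smul_sum, smul_smul, mul_comm]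

/-! ### Factoring the band through unitaries, and complete positivity of φ. -/

/-- If a `*`-homomorphism maps `u_j` to `W_j^* W_{j+1}` for unitaries `W_j`, then it maps the
entries of `band` near the diagonal to `W_k^* W_l`. -/
lemma map_band {B : Type} [CStarAlgebra B] {n : ℕ} {u : Fin (n - 1) → A} (π : A →⋆ₐ[ℂ] B)
    {W : ℕ → B} (hW : ∀ k, star (W k) * W k = 1)
    (hπ : ∀ j : Fin (n - 1), π (u j) = star (W j) * W (j + 1)) {k l : Fin n}
    (hkl : ¬ 2 ≤ |(k : ℤ) - (l : ℤ)|) : π (band u k l) = star (W k) * W l := by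
  unfold band
  split_ifs with h1 h2 h3
  · rw [h1, hW, map_one]
  · rw [hπ, h2]
  · rw [map_star, hπ, star_mul, star_star, h3]
  · exfalso
    apply hkl
    rw [le_abs]
    have := Fin.val_ne_of_ne h1
    omega

/-- Off the band X vanishes, so W_k^* W_l may replace the zero entry of `band` there. This is what
lets a full Gram matrix represent a map defined only on tridiagonal matrices. It serves twice: with
the identity and the partial products, and with a representation built from separating vectors. -/
lemma map_coe_phi {B : Type} [CStarAlgebra B] {n : ℕ} {u : Fin (n - 1) → A} (π : A →⋆ₐ[ℂ] B)
    {W : ℕ → B} (hW : ∀ k, star (W k) * W k = 1)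
    (hπ : ∀ j : Fin (n - 1), π (u j) = star (W j) * W (j + 1)) (X : T n) :
    π (phi u X) = (1 / (n : ℂ)) • ∑ k : Fin n, ∑ l : Fin n, X.1 k l • (star (W k) * W l) := by
  rw [coe_phi, map_smul, map_sum]
  congr 1
  refine Finset.sum_congr rfl fun k _ => ?_
  rw [map_sum]
  refine Finset.sum_congr rfl fun l _ => ?_
  rw [map_smul]
  by_cases hkl : 2 ≤ |(k : ℤ) - (l : ℤ)|
  · rw [X.2 k l hkl, zero_smul, zero_smul]
  · rw [map_band π hW hπ hkl]

/-- The products `w_k = u_0 ⋯ u_{k-1}`. -/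
def partialProd {n : ℕ} (u : Fin (n - 1) → A) : ℕ → A
  | 0 => 1
  -- The value 1 past the last generator only makes the sequence total; indices k < n never reach
  -- it.
  | k + 1 => partialProd u k * if h : k < n - 1 then u ⟨k, h⟩ else 1

lemma star_partialProd_mul {n : ℕ} {u : Fin (n - 1) → A} (hu : ∀ i, u i ∈ unitary A) (k : ℕ) :
    star (partialProd u k) * partialProd u k = 1 := by
  have h : partialProd u k ∈ unitary A := by
    induction k with
    | zero => exact one_mem _
    | succ k ih =>
      refine mul_mem ih ?_
      split_ifs
      · exact hu _
      · exact one_mem _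
  exact (Unitary.mem_iff.1 h).1

/-- The partial products satisfy w_k^* w_{k+1} = u_k, so a factorization B^* B of the flattened
matrix gives n φ(X) = Z^* Z with Z_{m,b} = ∑_l B_{m,(b,l)} w_l. -/
theorem isCP_phi {n : ℕ} {u : Fin (n - 1) → A} (hu : ∀ i, u i ∈ unitary A) :
    (TSys n).IsCP (SSys u) (phi u) := by
  intro p X hX
  obtain ⟨B, hB⟩ := ((mem_cone_TSys_iff X).1 hX).exists_eq_conjTranspose_mul_self
  let w := partialProd u
  have hphi : ∀ x : T n, (phi u x : A) =
      (1 / (n : ℂ)) • ∑ k : Fin n, ∑ l : Fin n, x.1 k l • (star (w k) * w l) := by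
    refine map_coe_phi (StarAlgHom.id ℂ A) (star_partialProd_mul hu) fun j => ?_
    have hj : partialProd u (j + 1) = partialProd u j * u j := by simp [partialProd]
    change u j = star (partialProd u j) * partialProd u (j + 1)
    rw [hj, ← mul_assoc, star_partialProd_mul hu, one_mul]
  let Z : Matrix (Fin (p * n)) (Fin p) A :=
    of fun m b => ∑ l : Fin n, B (finProdFinEquiv.symm m) (b, l) • w l
  let _ := CStarAlgebra.spectralOrder A
  let _ := CStarAlgebra.spectralOrderedRing A
  have hZ : (n : ℂ) • X.map (phi u) ∈ (SSys u).cone p := by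
    change IsPosMat (((n : ℂ) • X.map (phi u)).map (S u).subtype)
    convert isPosMat_rect Z using 1
    ext a b
    have hXB : ∀ k l, (X a b).1 k l = ∑ m, star (B m (a, k)) * B m (b, l) := by
      intro k l
      have h1 := congrFun (congrFun hB (a, k)) (b, l)
      simpa [flatten, Matrix.mul_apply] using h1
    simp only [map_apply, Matrix.smul_apply, map_smul, Submodule.subtype_apply, hphi, Matrix.mul_apply,
      conjTranspose_apply]
    rcases Nat.eq_zero_or_pos n with rfl | hn
    · simp [Z]
    rw [smul_smul, mul_one_div_cancel (by exact_mod_cast hn.ne'), one_smul,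
      ← finProdFinEquiv.sum_comp]
    simp only [Z, of_apply, Equiv.symm_apply_apply, star_sum, star_smul, Finset.sum_mul_sum,
      smul_mul_smul_comm, hXB, Finset.sum_smul]
    symm
    rw [Finset.sum_comm]
    exact Finset.sum_congr rfl fun k _ => Finset.sum_comm
  have h := (SSys u).cone_smul (1 / (n : ℝ)) (by positivity) hZ
  -- For n = 0 the factor n cannot be divided out, but φ is then zero and `hZ` already speaks of the
  -- zero matrix.
  rcases Nat.eq_zero_or_pos n with rfl | hn
  · convert hZ using 1
    ext a b
    simp [hphi]
  · rw [smul_smul] at h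
    convert h using 1
    rw [Complex.ofReal_div, Complex.ofReal_one, Complex.ofReal_natCast,
      one_div_mul_cancel (by exact_mod_cast hn.ne'), one_smul]

/-! ### Lifting positivity from the span of the unitaries to T_n. -/

section

variable {F : Type*} [NormedAddCommGroup F] [InnerProductSpace ℂ F] [CompleteSpace F]
  {α β : Type*} [Fintype α] [Fintype β]

/-- Moving each Y_{ca}^* across the inner product exhibits the form of Y^* Y as a sum of squared
norms. -/
lemma sum_inner_sum_star_mul (Y : β → α → F →L[ℂ] F) (x : α → F) :
    ∑ a, ∑ b, inner ℂ (x a) ((∑ c, star (Y c a) * Y c b) (x b)) =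
      ∑ c, inner ℂ (∑ a, Y c a (x a)) (∑ b, Y c b (x b)) := by
  simp only [sum_inner, inner_sum, _root_.sum_apply, mul_apply_eq_comp,
    ContinuousLinearMap.star_eq_adjoint, ContinuousLinearMap.adjoint_inner_right]
  rw [Finset.sum_comm' (t' := Finset.univ) (s' := fun _ => Finset.univ) (by simp)]
  simp only [Finset.sum_comm (s := (Finset.univ : Finset β))]

lemma inner_smul_sum_star_mul (r : ℂ) (X : Matrix α α ℂ) (W : α → F →L[ℂ] F) (x y : F) :
    inner ℂ x ((r • ∑ k, ∑ l, X k l • (star (W k) * W l)) y) =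
      r * ∑ k, ∑ l, X k l * inner ℂ (W k x) (W l y) := by
  simp only [_root_.smul_apply, _root_.sum_apply, inner_smul_right, inner_sum, mul_apply_eq_comp,
    ContinuousLinearMap.star_eq_adjoint, ContinuousLinearMap.adjoint_inner_right]

end

/-- A positive matrix over the span of universal unitaries lifts to a positive matrix over `T_n`. -/
theorem exists_add_mem_cone {n : ℕ} (hn : 2 ≤ n) {u : Fin (n - 1) → A}
    (hu : IsUniversalUnitaries u) {p : ℕ} {X : Matrix (Fin p) (Fin p) (T n)}
    (hX : matAdj (TSys n).adj X = X) (hpos : X.map (phi u) ∈ (SSys u).cone p) :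
    ∃ K : Matrix (Fin p) (Fin p) (T n), matAdj (TSys n).adj K = K ∧
      (∀ i j, K i j ∈ (J n).submoduleOf (T n)) ∧ X + K ∈ (TSys n).cone p := by
  obtain ⟨K, hK, hXK⟩ := exists_posSemidef_add_blockTraceZero (flatten X)
    (isHermitian_flatten hX) (by
      intro y hy
      let F := EuclideanSpace ℂ (Fin p × Fin n)
      -- The block k = 0 is the reference: by hypothesis on y every other block has the same Gram
      -- matrix. Its existence needs n > 0.
      let x : Fin p → F := fun a => y (a, ⟨0, by omega⟩)
      have hex : ∀ k : Fin n, ∃ U : F ≃ₗᵢ[ℂ] F, ∀ a, U (x a) = y (a, k) := fun k =>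
        exists_linearIsometryEquiv_of_inner_eq x (fun a => y (a, k)) fun a b => hy a b _ k
      choose U hU using hex
      let V : ℕ → unitary (F →L[ℂ] F) := fun k =>
        if h : k < n then Unitary.linearIsometryEquiv.symm (U ⟨k, h⟩) else 1
      have hV : ∀ (a : Fin p) (k : Fin n), (V k : F →L[ℂ] F) (x a) = y (a, k) := by
        intro a k
        simp only [V, k.2, dite_true]
        exact hU k a
      have hV1 : ∀ k, star (V k : F →L[ℂ] F) * V k = 1 := fun k => (Unitary.mem_iff.1 (V k).2).1
      -- Universality is used here, with the quotients of consecutive V_j as target unitaries; the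
      -- band entries then go to V_k^* V_l.
      obtain ⟨π, hπ⟩ := hu.universal (F →L[ℂ] F)
        (fun j : Fin (n - 1) => star (V j : F →L[ℂ] F) * V (j + 1))
        (fun j => (star (V j) * V (j + 1)).2)
      obtain ⟨Y, hY⟩ := hpos
      have hY' : ∀ a b, π (phi u (X a b)) = ∑ c, star (π (Y c a)) * π (Y c b) := by
        intro a b
        have h1 := congrFun (congrFun hY a) b
        simp only [map_apply, Submodule.subtype_apply, Matrix.mul_apply, conjTranspose_apply] at h1
        simp only [h1, map_sum, map_mul, map_star]
      have h1 : ∑ a, ∑ b, inner ℂ (x a) (π (phi u (X a b)) (x b)) =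
          ∑ c, inner ℂ (∑ a, π (Y c a) (x a)) (∑ b, π (Y c b) (x b)) := by
        simp only [hY']
        exact sum_inner_sum_star_mul (fun c a => π (Y c a)) x
      have h2 : ∀ a b, inner ℂ (x a) (π (phi u (X a b)) (x b)) =
          (1 / (n : ℂ)) * ∑ k, ∑ l, (X a b).1 k l * inner ℂ (y (a, k)) (y (b, l)) := by
        intro a b
        rw [map_coe_phi π hV1 hπ]
        refine (inner_smul_sum_star_mul _ _ (fun k : Fin n => (V k : F →L[ℂ] F)) _ _).trans ?_
        simp only [hV]
      -- The Gram pairing is n times the form of π(φ(X)) at x, because V_k sends x_a to y_{(a,k)}.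
      have h3 : ∑ i, ∑ j, flatten X i j * inner ℂ (y i) (y j) =
          (n : ℂ) * ∑ c, inner ℂ (∑ a, π (Y c a) (x a)) (∑ b, π (Y c b) (x b)) := by
        rw [← h1]
        simp only [h2, ← Finset.mul_sum, Fintype.sum_prod_type, flatten, of_apply]
        rw [← mul_assoc, mul_one_div_cancel (by norm_cast; omega), one_mul]
        refine Finset.sum_congr rfl fun a _ => ?_
        rw [Finset.sum_comm]
      rw [h3, ← Complex.ofReal_natCast, Complex.re_ofReal_mul, Complex.re_sum]
      exact mul_nonneg (Nat.cast_nonneg n) (Finset.sum_nonneg fun c _ =>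
        inner_self_nonneg (𝕜 := ℂ)))
  have hKd : ∀ a b, (of fun k l => K (a, k) (b, l) : Matrix (Fin n) (Fin n) ℂ) ∈ J n :=
    fun a b => ⟨fun k l hkl => hK.1 a b k l hkl, hK.2 a b⟩
  let L : Matrix (Fin p) (Fin p) (T n) := of fun a b => ⟨_, J_le_T n (hKd a b)⟩
  have hL : X + L ∈ (TSys n).cone p := by
    rw [mem_cone_TSys_iff]
    exact hXK
  refine ⟨L, ?_, hKd, hL⟩
  -- The correction is selfadjoint for free: X + L is positive, hence selfadjoint, and so is X.
  have := (TSys n).cone_adj hL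
  rw [matAdj_add, hX] at this
  exact add_left_cancel this

/-! ### The kernel, proximinality and the quotient map. -/

lemma J_le_ker_phi {n : ℕ} (u : Fin (n - 1) → A) :
    (J n).submoduleOf (T n) ≤ LinearMap.ker (phi u) := by
  rintro ⟨X, hXT⟩ hX
  obtain ⟨hd, ht⟩ : X ∈ J n := hX
  rw [LinearMap.mem_ker]
  apply Subtype.ext
  rw [coe_phi]
  have h : ∀ k, ∑ l, X k l • band u k l = X k k • (1 : A) := by
    intro k
    rw [Finset.sum_eq_single k]
    · simp [band]
    · intro l _ hl
      rw [hd hl.symm, zero_smul]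
    · simp
  simp only [h, ← Finset.sum_smul]
  rw [show ∑ k, X k k = 0 from ht, zero_smul, smul_zero]
  rfl

/-- A positive matrix over the diagonal matrices of trace zero vanishes. -/
lemma eq_zero_of_mem_cone {n p : ℕ} {K : Matrix (Fin p) (Fin p) (T n)}
    (hK : ∀ i j, K i j ∈ (J n).submoduleOf (T n)) (hpos : K ∈ (TSys n).cone p) : K = 0 := by
  rw [mem_cone_TSys_iff] at hpos
  have ht : (flatten K).trace = 0 := by
    simp only [Matrix.trace, Fintype.sum_prod_type]
    exact Finset.sum_eq_zero fun a _ => (hK a a).2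
  ext a b k l
  have := hpos.norm_apply_le_trace (a, k) (b, l)
  rw [ht, Complex.zero_re, norm_le_zero_iff] at this
  exact this

/-- For selfadjoint X in the kernel, φ(X) and φ(−X) are both positive, so X + K and −X + L are
positive for some K, L in J_n. Their sum K + L is positive of trace zero, hence 0. Then X + K and
its negative are both positive, so X = −K. -/
theorem ker_phi {n : ℕ} (hn : 2 ≤ n) {u : Fin (n - 1) → A} (hu : IsUniversalUnitaries u) :
    LinearMap.ker (phi u) = (J n).submoduleOf (T n) := by
  refine le_antisymm ?_ (J_le_ker_phi u)
  have key : ∀ X : T n, (TSys n).adj X = X → phi u X = 0 → X ∈ (J n).submoduleOf (T n) := by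
    have h0 : ∀ X : T n, (TSys n).adj X = X → phi u X = 0 →
        ∃ K ∈ (J n).submoduleOf (T n), (of fun _ _ => X + K) ∈ (TSys n).cone 1 := by
      intro X hX h
      obtain ⟨K, -, hK, hXK⟩ := exists_add_mem_cone (p := 1) hn hu (X := of fun _ _ => X)
        (Matrix.ext fun _ _ => hX) (by
          have : (of fun _ _ => X : Matrix (Fin 1) (Fin 1) (T n)).map (phi u) = 0 := by
            exact Matrix.ext fun _ _ => h
          rw [this]
          exact ⟨0, by ext; simp⟩)
      refine ⟨K 0 0, hK 0 0, ?_⟩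
      convert hXK using 1
      refine Matrix.ext fun i j => ?_
      rw [Subsingleton.elim i 0, Subsingleton.elim j 0]
      rfl
    intro X hX h
    obtain ⟨K, hK, h1⟩ := h0 X hX h
    obtain ⟨L, hL, h2⟩ := h0 (-X) (by rw [map_neg, hX]) (by rw [map_neg, h, neg_zero])
    have h3 := (TSys n).cone_add h1 h2
    have h4 : (of fun _ _ => X + K : Matrix (Fin 1) (Fin 1) (T n)) + (of fun _ _ => -X + L) =
        of fun _ _ => K + L := by
      refine Matrix.ext fun i j => ?_
      simp only [Matrix.add_apply, of_apply]
      abel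
    rw [h4] at h3
    have h5 : K + L = 0 :=
      congrFun (congrFun (eq_zero_of_mem_cone (fun _ _ => add_mem hK hL) h3) 0) 0
    have h6 : (of fun _ _ => -X + L : Matrix (Fin 1) (Fin 1) (T n)) = -of fun _ _ => X + K := by
      refine Matrix.ext fun i j => ?_
      simp only [Matrix.neg_apply, of_apply]
      rw [eq_neg_of_add_eq_zero_right h5]
      abel
    rw [h6] at h2
    have h7 : X + K = 0 := congrFun (congrFun ((TSys n).cone_proper h1 h2) 0) 0
    rw [eq_neg_of_add_eq_zero_left h7]
    exact neg_mem hK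
  intro X hX
  rw [LinearMap.mem_ker] at hX
  have hX' : phi u ((TSys n).adj X) = 0 := by
    rw [(isCP_phi hu.unitary).map_adj, hX, map_zero]
  -- A general X reduces to its selfadjoint parts; the kernel is closed under the involution because
  -- φ is completely positive.
  have h1 := key (X + (TSys n).adj X) (by rw [map_add, (TSys n).adj_adj, add_comm])
    (by rw [map_add, hX, hX', add_zero])
  have h2 := key (Complex.I • (X - (TSys n).adj X))
    (by rw [map_smulₛₗ, map_sub, (TSys n).adj_adj, Complex.conj_I, neg_smul, ← smul_neg, neg_sub])
    (by rw [map_smul, map_sub, hX, hX', sub_zero, smul_zero])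
  have h3 : X = (1 / 2 : ℂ) • ((X + (TSys n).adj X) -
      Complex.I • (Complex.I • (X - (TSys n).adj X))) := by
    rw [smul_smul, Complex.I_mul_I]
    module
  rw [h3]
  exact Submodule.smul_mem _ _ (sub_mem h1 (Submodule.smul_mem _ _ h2))

lemma phi_surjective {n : ℕ} (hn : 2 ≤ n) (u : Fin (n - 1) → A) :
    Function.Surjective (phi u) := by
  have hn0 : (n : ℂ) ≠ 0 := by norm_cast; omega
  have hle : S u ≤ (LinearMap.range (phi u)).map (S u).subtype := by
    have hb : ∀ i j : Fin n, |(i : ℤ) - (j : ℤ)| ≤ 1 →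
        band u i j ∈ (LinearMap.range (phi u)).map (S u).subtype := by
      intro i j h
      refine ⟨(n : ℂ) • phi u ⟨Matrix.single i j 1, single_mem_T i j h⟩,
        Submodule.smul_mem _ _ ⟨_, rfl⟩, ?_⟩
      rw [map_smul, Submodule.subtype_apply, phi_single u i j h, smul_smul, mul_one_div_cancel hn0,
        one_smul]
    refine Submodule.span_le.2 ?_
    rintro x ((h | ⟨j, rfl⟩) | ⟨j, rfl⟩)
    · rw [Set.mem_singleton_iff.1 h]
      have := hb ⟨0, by omega⟩ ⟨0, by omega⟩ (by simp)
      simpa [band] using this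
    · have := hb ⟨j, by omega⟩ ⟨j + 1, by omega⟩ (by simp)
      simpa [band] using this
    · have := hb ⟨j + 1, by omega⟩ ⟨j, by omega⟩ (by simp)
      simpa [band, add_assoc] using this
  intro y
  obtain ⟨z, ⟨X, rfl⟩, hz⟩ := hle y.2
  exact ⟨X, Subtype.ext hz⟩

lemma D_subset_C {V : Type*} [AddCommGroup V] [Module ℂ V] (𝒮 : OperatorSystem V)
    (I : Submodule ℂ V) (p : ℕ) : 𝒮.D I p ⊆ 𝒮.C I p := by
  rintro x ⟨H, hH, hx, K, hK, hKI, hpos⟩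
  refine ⟨H, hH, hx, fun ε hε => ⟨K, hK, hKI, ?_⟩⟩
  rw [add_assoc]
  exact 𝒮.cone_add (𝒮.cone_smul ε hε.le (𝒮.unit_mem p)) hpos

/-- The Archimedean property of the target removes ε: a class in C_p has positive image under φ. The
lifting theorem then gives an exact correction K. -/
theorem isCompletelyOrderProximinal_ker_phi {n : ℕ} (hn : 2 ≤ n) {u : Fin (n - 1) → A}
    (hu : IsUniversalUnitaries u) :
    (TSys n).IsCompletelyOrderProximinal (LinearMap.ker (phi u)) := by
  have hcp := isCP_phi hu.unitary
  refine ⟨hcp.isKernel, fun p => (D_subset_C _ _ p).antisymm ?_⟩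
  intro x hx
  have h := hcp.liftQ_mem hx
  obtain ⟨H, hH, rfl, -⟩ := hx
  obtain ⟨K, hK, hKJ, hpos⟩ := exists_add_mem_cone hn hu hH h
  exact ⟨H, hH, rfl, K, hK, fun i j => J_le_ker_phi u (hKJ i j), hpos⟩

/-- Complete positivity of the inverse is the lifting theorem again: a selfadjoint preimage of a
positive matrix has its class in D_p, and D_p ⊆ C_p. -/
theorem isCompleteQuotientMap_phi {n : ℕ} (hn : 2 ≤ n) {u : Fin (n - 1) → A}
    (hu : IsUniversalUnitaries u) : (TSys n).IsCompleteQuotientMap (SSys u) (phi u) := by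
  have hcp := isCP_phi hu.unitary
  refine ⟨hcp, (phi u).quotKerEquivOfSurjective (phi_surjective hn u), ?_, ?_, ?_⟩
  · refine Submodule.linearMap_qext _ (LinearMap.ext fun x => ?_)
    rfl
  · intro p x hx
    exact hcp.liftQ_mem hx
  · intro p Y hY
    choose g hg using phi_surjective hn u
    let H : Matrix (Fin p) (Fin p) (T n) := Y.map g
    have hHY : H.map (phi u) = Y := by
      refine Matrix.ext fun i j => ?_
      exact hg _
    -- The chosen preimages need not respect the involution. Averaging with the adjoint keeps the
    -- image, because Y is selfadjoint and φ preserves adjoints.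
    let H' := ((1 / 2 : ℝ) : ℂ) • (H + matAdj (TSys n).adj H)
    have hH' : matAdj (TSys n).adj H' = H' := by
      rw [matAdj_smul, matAdj_add, matAdj_matAdj, add_comm]
    have hHY' : H'.map (phi u) = Y := by
      refine Matrix.ext fun i j => ?_
      have h1 : phi u (H i j) = Y i j := congrFun (congrFun hHY i) j
      have h2 : phi u ((TSys n).adj (H j i)) = Y i j := by
        have h3 : phi u (H j i) = Y j i := congrFun (congrFun hHY j) i
        rw [hcp.map_adj, h3]
        exact congrFun (congrFun ((SSys u).cone_adj hY) i) j
      simp only [H', map_apply, Matrix.smul_apply, Matrix.add_apply, matAdj, of_apply, map_smul, map_add, h1, h2]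
      push_cast
      module
    obtain ⟨K, hK, hKJ, hpos⟩ := exists_add_mem_cone hn hu hH' (by rwa [hHY'])
    refine D_subset_C _ _ p ⟨H', hH', ?_, K, hK, fun i j => J_le_ker_phi u (hKJ i j), hpos⟩
    refine Matrix.ext fun i j => ?_
    refine (LinearEquiv.eq_symm_apply _).2 ?_
    exact congrFun (congrFun hHY' i) j

end Tridiag

end

/-- The inclusion J_n ≤ T_n is recorded because `submoduleOf` is a preimage under the inclusion of
T_n; with it, nothing of J_n is lost. The remaining claims transfer along the kernel identity. -/
theorem mainTheorem12 (n : ℕ) (hn : 2 ≤ n)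
    (u : Fin (n - 1) → FullGroupCStar (FreeGroup (Fin (n - 1))))
    (hu : IsUniversalUnitaries u) :
    Tridiag.J n ≤ Tridiag.T n ∧
    LinearMap.ker (Tridiag.phi u) = (Tridiag.J n).submoduleOf (Tridiag.T n) ∧
    (Tridiag.TSys n).IsCompletelyOrderProximinal ((Tridiag.J n).submoduleOf (Tridiag.T n)) ∧
    (Tridiag.TSys n).IsCompleteQuotientMap (Tridiag.SSys u) (Tridiag.phi u) ∧
    ∃ (hJ : (Tridiag.TSys n).IsKernel ((Tridiag.J n).submoduleOf (Tridiag.T n)))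
      (e : (Tridiag.T n ⧸ (Tridiag.J n).submoduleOf (Tridiag.T n)) →ₗ[ℂ] Tridiag.S u),
      ((Tridiag.TSys n).quotient _ hJ).IsCompleteOrderIso (Tridiag.SSys u) e ∧
      ∀ X : Tridiag.T n, e (Submodule.Quotient.mk X) = Tridiag.phi u X := by
  have hker := Tridiag.ker_phi hn hu
  have hq := Tridiag.isCompleteQuotientMap_phi hn hu
  refine ⟨Tridiag.J_le_T n, hker, ?_, hq, ?_⟩
  · rw [← hker]
    exact Tridiag.isCompletelyOrderProximinal_ker_phi hn hu
  · rw [← hker]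
    obtain ⟨h, he⟩ := hq
    exact ⟨h.isKernel, _, he, fun X => rfl⟩
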